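/- Let $\mathbb T=\mathbb R/2\pi\mathbb Z$, let $\alpha<5$ and $s_1,s_2\in\mathbb R$. Consider on $\mathbb R\times\mathbb T$ the dispersion-generalized KP-I equation $$\partial_t u-\partial_xD_x^\alpha u-\partial_x^{-1}\partial_y^2u=u\,\partial_xu,\qquad u(0)=u_0,\tag{1}$$ where $D_x^\alpha$ and $\partial_x^{-1}$ are the Fourier multipliers $|\xi|^\alpha$ and $(i\xi)^{-1}$. Let $\omega_\alpha(\xi,k)=\xi|\xi|^\alpha+k^2/\xi$ for $(\xi,k)\in\mathbb R\times\mathbb Z$, and let $S_\alpha(t)$ be the Fourier multiplier $e^{it\omega_\alpha}$. Let $H$ be either the space $H^{s_1,s_2}(\mathbb R\times\mathbb T)$ of complex-valued distributions, with norm $\|f\|^2=\sum_{k\in\mathbb Z}\int_{\mathbb R}(1+\xi^2)^{s_1}(1+k^2)^{s_2}|\hat f(\xi,k)|^2\,d\xi$, or its real subspace of real-valued elements. For $u\in C([-T,T];H)$ the Duhamel integral $\int_0^tS_\alpha(-s)\partial_x(u^2)(s)\,ds$ is understood as the limit as $n\to\infty$, in the sense of distributions on $\{\xi\neq0\}$ on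 the Fourier side (tested, for each $k\in\mathbb Z$, against $\psi\in C_c^\infty(\mathbb R\setminus\{0\})$ in $\xi$), of the same integrals with $u$ replaced by its Fourier truncation $P_nu$ to $|\xi|,|k|\le n$. We call $u$ a solution of (1) on $[-T,T]$ if for every $t\in[-T,T]$ this limit exists and $$S_\alpha(-t)u(t)=u_0+\tfrac12\int_0^tS_\alpha(-s)\,\partial_x(u^2)(s)\,ds .$$ Theorem. There do not exist a time $T>0$, a real Banach space $X_T$ with a continuous linear injection $X_T\hookrightarrow C([-T,T];H)$ such that the Duhamel integral above exists for every $u\in X_T$ and every $t\in[-T,T]$, and an open neighbourhood $V$ of $0$ in $H$, such that * for every $u_0\in V$, equation (1) has exactly one solution $u=\Phi(u_0)$ in $X_T$; * the data-to-solution map $\Phi:V\to X_T$ is (real) Fréchet differentiable at $0$; * for every $t\in[-T,T]$ the flow map $\Gamma_t:V\to H$, $u_0\mapsto u(t)$, is of class $C^2$ (over $\mathbb R$). In particular, (1) has no unique local solution in any such $X_T$ with a data-to-solution map that is $C^2$ from $H$, or from a ball of $H$ around $0$, into $X_T$. -/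

import Mathlib

open MeasureTheory Filter Topology Set
open scoped ContDiff

universe u

noncomputable section

namespace KPCylinder

/-!  Functions and distributions on the cylinder `ℝ × 𝕋`, `𝕋 = ℝ / 2πℤ`, are represented by their
Fourier transforms on the dual group `ℝ × ℤ`, with
`f̂(ξ, k) = (2π)⁻² ∫_{ℝ × 𝕋} e^{-i(xξ + yk)} f(x, y) dx dy`,
`f(x, y) = ∑ₖ ∫ e^{i(xξ + yk)} f̂(ξ, k) dξ`.
With this normalisation the Fourier transform of a product is exactly the convolution.  -/

/-- Lebesgue measure times counting measure on the dual group `ℝ × ℤ` of the cylinder. -/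
def dualMeasure : Measure (ℝ × ℤ) :=
  (volume : Measure ℝ).prod (Measure.count : Measure ℤ)

/-- The measure `⟨ξ⟩^{2 s₁} ⟨k⟩^{2 s₂} dξ dk`, where `⟨a⟩ = (1 + a²)^{1/2}`. -/
def sobolevMeasure (s₁ s₂ : ℝ) : Measure (ℝ × ℤ) :=
  dualMeasure.withDensity fun p =>
    ENNReal.ofReal ((1 + p.1 ^ 2) ^ s₁ * (1 + (p.2 : ℝ) ^ 2) ^ s₂)

/-- The anisotropic Sobolev space `H^{s₁,s₂}(ℝ × 𝕋)` of complex valued distributions, on the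
Fourier side: `‖f‖² = ∑ₖ ∫ ⟨ξ⟩^{2 s₁} ⟨k⟩^{2 s₂} |f̂(ξ, k)|² dξ`. -/
abbrev Sobolev (s₁ s₂ : ℝ) : Type := Lp ℂ 2 (sobolevMeasure s₁ s₂)

lemma ae_neg_of_ae (s₁ s₂ : ℝ) {P : ℝ × ℤ → Prop} (h : ∀ᵐ p ∂(sobolevMeasure s₁ s₂), P p) :
    ∀ᵐ p ∂(sobolevMeasure s₁ s₂), P (-p) := by
  have hm : Measurable fun p : ℝ × ℤ =>
      ENNReal.ofReal ((1 + p.1 ^ 2) ^ s₁ * (1 + (p.2 : ℝ) ^ 2) ^ s₂) := by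
    refine ENNReal.measurable_ofReal.comp ?_
    refine Measurable.mul ?_ ?_
    · exact ((measurable_fst.pow_const 2).const_add 1).pow_const s₁
    · exact ((((measurable_from_top (f := fun k : ℤ => (k : ℝ))).comp measurable_snd).pow_const
        2).const_add 1).pow_const s₂
  have hne : ∀ p : ℝ × ℤ,
      ENNReal.ofReal ((1 + p.1 ^ 2) ^ s₁ * (1 + (p.2 : ℝ) ^ 2) ^ s₂) ≠ 0 := by
    intro p
    have : 0 < (1 + p.1 ^ 2) ^ s₁ * (1 + (p.2 : ℝ) ^ 2) ^ s₂ := by positivity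
    simpa using this
  have h' : ∀ᵐ p ∂dualMeasure, P p := by
    have := (ae_withDensity_iff hm).1 h
    filter_upwards [this] with p hp using hp (hne p)
  have hz : MeasurePreserving (fun k : ℤ => -k) Measure.count Measure.count :=
    Measure.measurePreserving_neg (Measure.count : Measure ℤ)
  have hq : MeasurePreserving (fun p : ℝ × ℤ => (-p.1, -p.2)) dualMeasure dualMeasure :=
    (Measure.measurePreserving_neg (volume : Measure ℝ)).prod hz
  exact (withDensity_absolutelyContinuous _ _).ae_le (hq.quasiMeasurePreserving.ae h')

/-- The real subspace of the real valued elements of `H^{s₁,s₂}(ℝ × 𝕋)`, i.e. of those with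
`f̂(-ξ, -k) = conj (f̂(ξ, k))`. -/
def realValued (s₁ s₂ : ℝ) : Submodule ℝ (Sobolev s₁ s₂) where
  carrier := {f | ∀ᵐ p ∂(sobolevMeasure s₁ s₂), f (-p) = (starRingEnd ℂ) (f p)}
  zero_mem' := by
    have h := Lp.coeFn_zero ℂ 2 (sobolevMeasure s₁ s₂)
    change ∀ᵐ p ∂(sobolevMeasure s₁ s₂), (0 : Sobolev s₁ s₂) (-p) =
      (starRingEnd ℂ) ((0 : Sobolev s₁ s₂) p)
    filter_upwards [h, ae_neg_of_ae s₁ s₂ h] with p h1 h2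
    rw [h1, h2]
    simp
  add_mem' := by
    intro f g hf hg
    have h := Lp.coeFn_add f g
    change ∀ᵐ p ∂(sobolevMeasure s₁ s₂), (f + g) (-p) = (starRingEnd ℂ) ((f + g) p)
    filter_upwards [h, ae_neg_of_ae s₁ s₂ h, hf, hg] with p h1 h2 h3 h4
    rw [h1, h2, Pi.add_apply, Pi.add_apply, map_add, h3, h4]
  smul_mem' := by
    intro c f hf
    have h := Lp.coeFn_smul c f
    change ∀ᵐ p ∂(sobolevMeasure s₁ s₂), (c • f) (-p) = (starRingEnd ℂ) ((c • f) p)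
    filter_upwards [h, ae_neg_of_ae s₁ s₂ h, hf] with p h1 h2 h3
    simp [h1, h2, h3]

/-- The dispersion relation `ω_α(ξ, k) = ξ|ξ|^α + k²/ξ`: the linear equation
`∂ₜ u - ∂ₓ Dₓ^α u - ∂ₓ⁻¹ ∂_y² u = 0` reads `∂ₜ û = i ω_α û`.  The value on the null set `ξ = 0`
is irrelevant. -/
def dispersion (α ξ : ℝ) (k : ℤ) : ℝ := ξ * |ξ| ^ α + (k : ℝ) ^ 2 / ξ

/-- The sharp Fourier truncation to `|ξ| ≤ n`, `|k| ≤ n`. -/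
def truncate (n : ℕ) (f : ℝ × ℤ → ℂ) : ℝ × ℤ → ℂ :=
  {p : ℝ × ℤ | |p.1| ≤ n ∧ |p.2| ≤ n}.indicator f

/-- Convolution on `ℝ × ℤ`, the Fourier transform of the product of two functions. -/
def conv (f g : ℝ × ℤ → ℂ) (p : ℝ × ℤ) : ℂ := ∫ q, f q * g (p - q) ∂dualMeasure

/-- Test functions in the frequency `ξ`: smooth, with compact support away from `ξ = 0`, where
the symbol of `∂ₓ⁻¹` is singular. -/
structure IsTest (ψ : ℝ → ℂ) : Prop where
  smooth : ContDiff ℝ ∞ ψ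
  compact : HasCompactSupport ψ
  away : (0 : ℝ) ∉ tsupport ψ

/-- The `k`-th Fourier mode in `y` of `∫₀ᵗ S(-s) ∂ₓ((Pₙ u)²)(s) ds`, tested in `ξ` against `ψ`.
Here `Pₙ` is the Fourier truncation, `S(t)` is the linear propagator (the Fourier multiplier
`e^{i t ω_α}`), and `U s` is the Fourier transform of `u(s)`. -/
def duhamelApprox (α : ℝ) (U : ℝ → ℝ × ℤ → ℂ) (t : ℝ) (k : ℤ) (ψ : ℝ → ℂ) (n : ℕ) : ℂ :=
  ∫ s in (0 : ℝ)..t, ∫ ξ : ℝ,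
    Complex.exp (-(Complex.I * (s * dispersion α ξ k : ℝ))) *
      (Complex.I * ξ * conv (truncate n (U s)) (truncate n (U s)) (ξ, k)) * ψ ξ

/-- The Duhamel integral `∫₀ᵗ S(-s) ∂ₓ(u²)(s) ds` is well defined for all `t ∈ [-T, T]`, as the
distributional limit of the Duhamel integrals of the Fourier truncations of `u`. -/
def HasDuhamel (α T : ℝ) (U : ℝ → ℝ × ℤ → ℂ) : Prop :=
  ∀ t ∈ Icc (-T) T, ∀ (k : ℤ) (ψ : ℝ → ℂ), IsTest ψ →
    ∃ L : ℂ, Tendsto (duhamelApprox α U t k ψ) atTop (𝓝 L)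

/-- `u` solves `∂ₜ u - ∂ₓ Dₓ^α u - ∂ₓ⁻¹ ∂_y² u = u ∂ₓ u`, `u(0) = u₀`, on `[-T, T]` in the integral
sense: `S(-t) u(t) - u₀ = ½ ∫₀ᵗ S(-s) ∂ₓ(u²)(s) ds` for all `t ∈ [-T, T]`. -/
def IsSolution (α T : ℝ) (U : ℝ → ℝ × ℤ → ℂ) (U₀ : ℝ × ℤ → ℂ) : Prop :=
  ∀ t ∈ Icc (-T) T, ∀ (k : ℤ) (ψ : ℝ → ℂ), IsTest ψ →
    Tendsto (fun n => (1 / 2 : ℂ) * duhamelApprox α U t k ψ n) atTop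
      (𝓝 (∫ ξ : ℝ,
        (Complex.exp (-(Complex.I * (t * dispersion α ξ k : ℝ))) * U t (ξ, k) - U₀ (ξ, k)) * ψ ξ))

variable {s₁ s₂ T : ℝ} {E : Submodule ℝ (Sobolev s₁ s₂)}

/-- The Fourier transforms of the values of a continuous curve `[-T, T] → H^{s₁,s₂}`. The constant
continuation outside `[-T, T]` is never used. -/
def curve (hT : 0 < T) (u : C(Icc (-T) T, E)) : ℝ → ℝ × ℤ → ℂ :=
  fun s => ((u (projIcc (-T) T (by linarith) s) : E) : Sobolev s₁ s₂)

/-- `X` is a Banach space continuously embedded by `ι` into `C([-T, T]; E)`, on which the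
nonlinearity is well defined, and the equation has, for every initial value in the open
neighbourhood `V` of `0`, exactly one solution `Φ u₀` in `X`.  The data-to-solution map `Φ` is
differentiable at `0` as a map into `X`, and for every `t ∈ [-T, T]` the flow map
`Γₜ : u₀ ↦ u(t)` is `C²` as a map from `V ⊆ E` to `E`. -/
structure IsC2Flow (α : ℝ) (hT : 0 < T) {X : Type u} [NormedAddCommGroup X] [NormedSpace ℝ X]
    (ι : X →L[ℝ] C(Icc (-T) T, E)) (V : Set E) (Φ : E → X) : Prop where
  injective : Function.Injective ι
  hasDuhamel : ∀ v : X, HasDuhamel α T (curve hT (ι v))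
  isOpen : IsOpen V
  zero_mem : (0 : E) ∈ V
  solution : ∀ u₀ ∈ V, IsSolution α T (curve hT (ι (Φ u₀))) (u₀ : Sobolev s₁ s₂)
  unique : ∀ u₀ ∈ V, ∀ v : X,
    IsSolution α T (curve hT (ι v)) (u₀ : Sobolev s₁ s₂) → v = Φ u₀
  differentiableAt_zero : DifferentiableAt ℝ Φ 0
  contDiffOn : ∀ t : Icc (-T) T, ContDiffOn ℝ 2 (fun u₀ => ι (Φ u₀) t) V

/-- Local well-posedness with `C²` flow of the dispersion-generalised KP-I equation on `ℝ × 𝕋` for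
small initial data in `E`, where `E` is `H^{s₁,s₂}(ℝ × 𝕋)` or its subspace of real valued elements:
there are a time `T > 0` and a function space `X ↪ C([-T, T]; E)` carrying a `C²` flow. -/
def C2WellPosed (α s₁ s₂ : ℝ) (E : Submodule ℝ (Sobolev s₁ s₂)) : Prop :=
  ∃ (T : ℝ) (hT : 0 < T) (X : Type u) (_ : NormedAddCommGroup X) (_ : NormedSpace ℝ X)
    (_ : CompleteSpace X) (ι : X →L[ℝ] C(Icc (-T) T, E)) (V : Set E) (Φ : E → X),
    IsC2Flow α hT ι V Φ

end KPCylinder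

end

noncomputable section

namespace KPCylinder

/-! A flow of class `C²` would make the second Picard iterate at `0` a bounded quadratic map of the
datum, and a low-high interaction shows that it is not.

Let `Q` be the limit of the truncated Duhamel integrals, tested against a fixed `ψ` at a fixed time.
It exists on all of the Banach space `X`, so the uniform boundedness principle makes `Q` continuous
on `X`, and `Q` is homogeneous of degree two. Dividing the equation for `Φ (ε • h)` by `ε` and
letting `ε → 0` shows that the derivative of `Φ` at `0` is the linear evolution
(`IsC2Flow.linearisation`). Dividing by `ε²` and using the Taylor bound for `Γₜ` shows that `Q` at
the linear evolution of `h` is at most a constant times `‖h‖²` times the dual norm of `ψ`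
(`IsC2Flow.exists_duhamel_bound`).

For the contradiction, `h` has height `1` at frequencies `(ξ, 0)` with `ξ ∼ γ`, and height `b =
weight(N, K)^{-1/2}` on a `ξ`-interval of length `γ` next to `(N, K)`; it is reflected to be real
valued. If `K² = (α + 1) N^{α + 2}`, then `∂_ξ ω_α(N, K) = 0` and the resonance function is of size
at most `1 + N^{α - 1} γ²`. While it stays bounded there is no oscillation up to a time independent
of `N`, and the derivative `∂ₓ` contributes a full factor `N`: the tested Duhamel integral is at
least a multiple of `N b γ²`. The upper bound is a multiple of `γ · b γ^{1/2}`. Hence `N² γ` would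
stay bounded. Keeping `N^{α - 1} γ² ≤ 1` while `N² γ → ∞` is possible for `α < 5`
(`exists_resonant_frequencies`); for `α ≤ 0` one may take `K = 0`, `γ = 1`. The factor `b` cancels,
so `s₁` and `s₂` play no role. -/

instance : SFinite dualMeasure := by unfold dualMeasure; infer_instance

/-! ### The weighted measure on the dual group and its slices. -/

/-- The weight `⟨ξ⟩^{2 s₁} ⟨k⟩^{2 s₂}` of the Sobolev norm. -/
def weight (s₁ s₂ : ℝ) (p : ℝ × ℤ) : ℝ := (1 + p.1 ^ 2) ^ s₁ * (1 + (p.2 : ℝ) ^ 2) ^ s₂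

lemma weight_pos (s₁ s₂ : ℝ) (p : ℝ × ℤ) : 0 < weight s₁ s₂ p := by unfold weight; positivity

lemma measurable_weight (s₁ s₂ : ℝ) : Measurable (weight s₁ s₂) := by
  refine Measurable.mul ?_ ?_
  · exact ((measurable_fst.pow_const 2).const_add 1).pow_const s₁
  · exact ((((measurable_from_top (f := fun k : ℤ => (k : ℝ))).comp measurable_snd).pow_const
      2).const_add 1).pow_const s₂

lemma ae_sobolevMeasure_iff {s₁ s₂ : ℝ} {P : ℝ × ℤ → Prop} :
    (∀ᵐ p ∂(sobolevMeasure s₁ s₂), P p) ↔ ∀ᵐ p ∂dualMeasure, P p := by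
  have h := ae_withDensity_iff (μ := dualMeasure) (p := P) (measurable_weight s₁ s₂).ennreal_ofReal
  refine h.trans (eventually_congr (Eventually.of_forall fun p => ?_))
  simp [weight_pos s₁ s₂ p]

lemma lintegral_sobolevMeasure (s₁ s₂ : ℝ) (F : ℝ × ℤ → ENNReal) (hF : Measurable F) :
    ∫⁻ p, F p ∂(sobolevMeasure s₁ s₂) =
      ∫⁻ p, ENNReal.ofReal (weight s₁ s₂ p) * F p ∂dualMeasure :=
  lintegral_withDensity_eq_lintegral_mul _ (measurable_weight s₁ s₂).ennreal_ofReal hF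

lemma lintegral_dualMeasure (F : ℝ × ℤ → ENNReal) (hF : Measurable F) :
    ∫⁻ p, F p ∂dualMeasure = ∑' k : ℤ, ∫⁻ ξ : ℝ, F (ξ, k) := by
  rw [dualMeasure, lintegral_prod_symm' _ hF, lintegral_count]

lemma lintegral_slice_le (F : ℝ × ℤ → ENNReal) (hF : Measurable F) (k : ℤ) :
    ∫⁻ ξ : ℝ, F (ξ, k) ≤ ∫⁻ p, F p ∂dualMeasure := by
  rw [lintegral_dualMeasure F hF]
  exact ENNReal.le_tsum k

lemma ae_slice {P : ℝ × ℤ → Prop} (h : ∀ᵐ p ∂dualMeasure, P p) (k : ℤ) :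
    ∀ᵐ ξ : ℝ, P (ξ, k) := by
  have h' := Measure.ae_ae_of_ae_prod
    ((Measure.measurePreserving_swap (μ := (Measure.count : Measure ℤ))
      (ν := (volume : Measure ℝ))).quasiMeasurePreserving.ae h)
  exact (Measure.ae_count_iff.1 h') k

/-- A countable union of null slices is null; `P` need not be measurable. -/
lemma ae_of_slice {P : ℝ × ℤ → Prop} (h : ∀ k : ℤ, ∀ᵐ ξ : ℝ, P (ξ, k)) :
    ∀ᵐ p ∂dualMeasure, P p := by
  have hs : {p : ℝ × ℤ | ¬ P p} ⊆ ⋃ k : ℤ, toMeasurable volume {ξ : ℝ | ¬ P (ξ, k)} ×ˢ {k} := by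
    rintro ⟨ξ, k⟩ hp
    exact mem_iUnion.2 ⟨k, subset_toMeasurable _ _ hp, rfl⟩
  refine measure_mono_null hs (measure_iUnion_null fun k => ?_)
  rw [dualMeasure, Measure.prod_prod, measure_toMeasurable, ae_iff.1 (h k), zero_mul]

lemma measurePreserving_const_sub (p : ℝ × ℤ) :
    MeasurePreserving (fun q => p - q) dualMeasure dualMeasure :=
  (Measure.measurePreserving_sub_left volume p.1).prod
    (Measure.measurePreserving_sub_left Measure.count p.2)

lemma lintegral_enorm_sq {s₁ s₂ : ℝ} (f : Sobolev s₁ s₂) :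
    ∫⁻ p, ENNReal.ofReal (weight s₁ s₂ p) * ‖f p‖ₑ ^ (2 : ℝ) ∂dualMeasure =
      ENNReal.ofReal ‖f‖ ^ (2 : ℝ) := by
  have hm : Measurable f := (Lp.stronglyMeasurable f).measurable
  rw [← lintegral_sobolevMeasure s₁ s₂ _ (hm.enorm.pow_const 2), ofReal_norm,
    Lp.enorm_def, eLpNorm_eq_lintegral_rpow_enorm_toReal (by norm_num) (by norm_num),
    ← ENNReal.rpow_mul]
  norm_num

/-! ### Duality between a single Fourier mode and functions of `ξ`. -/

/-- The dual norm `(∫ |m(ξ)|² ⟨ξ⟩^{-2 s₁} ⟨k⟩^{-2 s₂} dξ)^{1/2}`. -/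
def dualNorm (s₁ s₂ : ℝ) (k : ℤ) (m : ℝ → ℂ) : ENNReal :=
  (∫⁻ ξ : ℝ, (‖m ξ‖ₑ * ENNReal.ofReal (weight s₁ s₂ (ξ, k) ^ (-(1 / 2) : ℝ))) ^ (2 : ℝ)) ^
    (1 / (2 : ℝ))

/-- Cauchy–Schwarz with the weight split as `w^{-1/2} · w^{1/2}`; the norm of one slice is at most
the full Sobolev norm. -/
lemma lintegral_pairing_le {s₁ s₂ : ℝ} (k : ℤ) {m : ℝ → ℂ} (hm : Measurable m)
    (g : Sobolev s₁ s₂) :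
    ∫⁻ ξ : ℝ, ‖m ξ * g (ξ, k)‖ₑ ≤ dualNorm s₁ s₂ k m * ENNReal.ofReal ‖g‖ := by
  have hg : Measurable g := (Lp.stronglyMeasurable g).measurable
  have hk : Measurable fun ξ : ℝ => ((ξ, k) : ℝ × ℤ) := measurable_prodMk_right
  have hw : Measurable fun ξ : ℝ => weight s₁ s₂ (ξ, k) := (measurable_weight s₁ s₂).comp hk
  have h1 : ∀ ξ : ℝ, ‖m ξ * g (ξ, k)‖ₑ =
      (‖m ξ‖ₑ * ENNReal.ofReal (weight s₁ s₂ (ξ, k) ^ (-(1 / 2) : ℝ))) *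
        (ENNReal.ofReal (weight s₁ s₂ (ξ, k) ^ (1 / 2 : ℝ)) * ‖g (ξ, k)‖ₑ) := fun ξ => by
    have hp := weight_pos s₁ s₂ (ξ, k)
    have : ENNReal.ofReal (weight s₁ s₂ (ξ, k) ^ (-(1 / 2) : ℝ)) *
        ENNReal.ofReal (weight s₁ s₂ (ξ, k) ^ (1 / 2 : ℝ)) = 1 := by
      rw [← ENNReal.ofReal_mul (by positivity), ← Real.rpow_add hp]
      simp
    rw [enorm_mul]
    calc _ = ‖m ξ‖ₑ * ‖g (ξ, k)‖ₑ * 1 := by ring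
      _ = _ := by rw [← this]; ring
  simp_rw [h1]
  refine (ENNReal.lintegral_mul_le_Lp_mul_Lq volume (Real.HolderConjugate.two_two)
    ((hm.enorm.mul (hw.pow_const _).ennreal_ofReal).aemeasurable)
    (((hw.pow_const _).ennreal_ofReal.mul (hg.comp hk).enorm).aemeasurable)).trans ?_
  refine mul_le_mul_right ?_ _
  rw [one_div, ENNReal.rpow_inv_le_iff (by norm_num), ← lintegral_enorm_sq g]
  refine le_trans (lintegral_mono fun ξ => ?_) (lintegral_slice_le _
    ((measurable_weight s₁ s₂).ennreal_ofReal.mul (hg.enorm.pow_const 2)) k)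
  rw [Pi.mul_apply, ENNReal.mul_rpow_of_nonneg _ _ (by norm_num),
    ENNReal.ofReal_rpow_of_nonneg (Real.rpow_nonneg (weight_pos s₁ s₂ _).le _) (by norm_num),
    ← Real.rpow_mul (weight_pos s₁ s₂ _).le]
  norm_num

lemma integrable_pairing {s₁ s₂ : ℝ} {k : ℤ} {m : ℝ → ℂ} (hm : Measurable m)
    (hd : dualNorm s₁ s₂ k m ≠ ⊤) (g : Sobolev s₁ s₂) :
    Integrable fun ξ : ℝ => m ξ * g (ξ, k) := by
  have hg : Measurable g := (Lp.stronglyMeasurable g).measurable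
  refine ⟨(hm.mul (hg.comp measurable_prodMk_right)).aestronglyMeasurable, ?_⟩
  exact (lintegral_pairing_le k hm g).trans_lt
    (ENNReal.mul_lt_top hd.lt_top ENNReal.ofReal_lt_top)

lemma norm_pairing_le {s₁ s₂ : ℝ} {k : ℤ} {m : ℝ → ℂ} (hm : Measurable m)
    (hd : dualNorm s₁ s₂ k m ≠ ⊤) (g : Sobolev s₁ s₂) :
    ‖∫ ξ : ℝ, m ξ * g (ξ, k)‖ ≤ (dualNorm s₁ s₂ k m).toReal * ‖g‖ := by
  rw [← ENNReal.toReal_ofReal (norm_nonneg g), ← ENNReal.toReal_mul]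
  rw [← ENNReal.ofReal_le_iff_le_toReal (ENNReal.mul_ne_top hd ENNReal.ofReal_ne_top),
    ofReal_norm]
  exact (enorm_integral_le_lintegral_enorm _).trans (lintegral_pairing_le k hm g)

/-- The pairing of the `k`-th mode of an element of the Sobolev space with a function of `ξ`. -/
def pairing {s₁ s₂ : ℝ} (k : ℤ) (m : ℝ → ℂ) (hm : Measurable m)
    (hd : dualNorm s₁ s₂ k m ≠ ⊤) : Sobolev s₁ s₂ →L[ℝ] ℂ :=
  LinearMap.mkContinuous
    { toFun := fun g => ∫ ξ : ℝ, m ξ * g (ξ, k)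
      map_add' := fun f g => by
        rw [← integral_add (integrable_pairing hm hd f) (integrable_pairing hm hd g)]
        refine integral_congr_ae ?_
        filter_upwards [ae_slice (ae_sobolevMeasure_iff.1 (Lp.coeFn_add f g)) k] with ξ h
        rw [h, Pi.add_apply, mul_add]
      map_smul' := fun c g => by
        rw [RingHom.id_apply, ← integral_smul]
        refine integral_congr_ae ?_
        filter_upwards [ae_slice (ae_sobolevMeasure_iff.1 (Lp.coeFn_smul c g)) k] with ξ h
        rw [h, Pi.smul_apply, mul_smul_comm] }
    (dualNorm s₁ s₂ k m).toReal (norm_pairing_le hm hd)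

lemma dualNorm_congr {s₁ s₂ : ℝ} {k : ℤ} {m m' : ℝ → ℂ} (h : ∀ ξ, ‖m ξ‖ = ‖m' ξ‖) :
    dualNorm s₁ s₂ k m = dualNorm s₁ s₂ k m' := by
  have h' : ∀ ξ, ‖m ξ‖ₑ = ‖m' ξ‖ₑ := fun ξ => by rw [← ofReal_norm, h, ofReal_norm]
  simp_rw [dualNorm, h']

/-- A bound for the dual norm of a function that vanishes off `A`. -/
lemma dualNorm_le {s₁ s₂ : ℝ} {k : ℤ} {m : ℝ → ℂ} {A : Set ℝ} {B : ℝ} (hA : MeasurableSet A)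
    (h0 : ∀ ξ ∉ A, m ξ = 0) (hB : ∀ ξ ∈ A, ‖m ξ‖ ^ 2 ≤ B * weight s₁ s₂ (ξ, k)) :
    dualNorm s₁ s₂ k m ≤ (ENNReal.ofReal B * volume A) ^ (1 / (2 : ℝ)) := by
  refine ENNReal.rpow_le_rpow ?_ (by norm_num)
  rw [← lintegral_indicator_const hA]
  refine lintegral_mono fun ξ => ?_
  by_cases hξ : ξ ∈ A
  · have hw := weight_pos s₁ s₂ (ξ, k)
    rw [indicator_of_mem hξ, ENNReal.mul_rpow_of_nonneg _ _ (by norm_num), ← ofReal_norm,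
      ENNReal.ofReal_rpow_of_nonneg (norm_nonneg _) (by norm_num),
      ENNReal.ofReal_rpow_of_nonneg (Real.rpow_nonneg hw.le _) (by norm_num),
      ← ENNReal.ofReal_mul (by positivity), ← Real.rpow_mul hw.le]
    refine ENNReal.ofReal_le_ofReal ?_
    have : (-(1 / 2) : ℝ) * 2 = -1 := by norm_num
    rw [this, Real.rpow_neg_one, ← div_eq_mul_inv, div_le_iff₀ hw, Real.rpow_two]
    exact hB ξ hξ
  · simp [indicator_of_notMem hξ, h0 ξ hξ]

lemma IsTest.dualNorm_ne_top {ψ : ℝ → ℂ} (h : IsTest ψ) (s₁ s₂ : ℝ) (k : ℤ) :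
    dualNorm s₁ s₂ k ψ ≠ ⊤ := by
  have hw : Continuous fun ξ : ℝ => weight s₁ s₂ (ξ, k) := by
    unfold weight
    refine Continuous.mul (Continuous.rpow_const (by fun_prop) fun ξ => Or.inl ?_)
      (continuous_const (y := (1 + (k : ℝ) ^ 2) ^ s₂))
    positivity
  have hc : Continuous fun ξ : ℝ => ‖ψ ξ‖ ^ 2 / weight s₁ s₂ (ξ, k) :=
    (h.smooth.continuous.norm.pow 2).div hw fun ξ => (weight_pos s₁ s₂ _).ne'
  obtain ⟨B, hB⟩ := h.compact.isCompact.bddAbove_image (hc.continuousOn (s := tsupport ψ))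
  refine ne_top_of_le_ne_top ?_ (dualNorm_le (A := tsupport ψ) (B := B)
    (isClosed_tsupport ψ).measurableSet (fun ξ hξ => image_eq_zero_of_notMem_tsupport hξ)
    fun ξ hξ => (div_le_iff₀ (weight_pos s₁ s₂ _)).1 (hB ⟨ξ, hξ, rfl⟩))
  exact ENNReal.rpow_ne_top_of_nonneg (by norm_num)
    (ENNReal.mul_ne_top ENNReal.ofReal_ne_top h.compact.isCompact.measure_lt_top.ne)

/-! ### Convolution of truncated functions as bounded bilinear forms. -/

section

/-- Cauchy–Schwarz, with the invariance of the measure under `q ↦ p - q`. -/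
lemma lintegral_conv_le {f g : ℝ × ℤ → ℂ} (hf : Measurable f) (hg : Measurable g) (p : ℝ × ℤ) :
    ∫⁻ q, ‖f q * g (p - q)‖ₑ ∂dualMeasure ≤
      (∫⁻ q, ‖f q‖ₑ ^ (2 : ℝ) ∂dualMeasure) ^ (1 / (2 : ℝ)) *
        (∫⁻ q, ‖g q‖ₑ ^ (2 : ℝ) ∂dualMeasure) ^ (1 / (2 : ℝ)) := by
  have hp := measurePreserving_const_sub p
  rw [← hp.lintegral_comp (hg.enorm.pow_const 2)]
  simp_rw [enorm_mul]
  exact ENNReal.lintegral_mul_le_Lp_mul_Lq dualMeasure Real.HolderConjugate.two_two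
    hf.enorm.aemeasurable (hg.comp hp.measurable).enorm.aemeasurable

lemma conv_congr_ae {f f' g g' : ℝ × ℤ → ℂ} (hf : f =ᵐ[dualMeasure] f')
    (hg : g =ᵐ[dualMeasure] g') (p : ℝ × ℤ) : conv f g p = conv f' g' p := by
  refine integral_congr_ae ?_
  filter_upwards [hf, (measurePreserving_const_sub p).quasiMeasurePreserving.ae hg] with q h1 h2
  rw [h1, h2]

lemma measurable_conv {f g : ℝ × ℤ → ℂ} (hf : Measurable f) (hg : Measurable g) :
    Measurable (conv f g) := by
  have h : Measurable fun x : (ℝ × ℤ) × (ℝ × ℤ) => f x.2 * g (x.1 - x.2) := by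
    refine (hf.comp measurable_snd).mul (hg.comp ?_)
    exact Measurable.prodMk
      ((measurable_fst.comp measurable_fst).sub (measurable_fst.comp measurable_snd))
      ((measurable_snd.comp measurable_fst).sub (measurable_snd.comp measurable_snd))
  exact (h.stronglyMeasurable.integral_prod_right (ν := dualMeasure)).measurable

lemma measurableSet_box (n : ℕ) : MeasurableSet {p : ℝ × ℤ | |p.1| ≤ n ∧ |p.2| ≤ n} :=
  (measurableSet_le measurable_fst.abs measurable_const).inter
    (measurable_snd (Set.to_countable {k : ℤ | |k| ≤ n}).measurableSet)

lemma measurable_truncate (n : ℕ) {f : ℝ × ℤ → ℂ} (hf : Measurable f) :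
    Measurable (truncate n f) := hf.indicator (measurableSet_box n)

lemma truncate_add (n : ℕ) (f g : ℝ × ℤ → ℂ) :
    truncate n (f + g) = truncate n f + truncate n g := indicator_add' _ _ _

lemma truncate_smul (n : ℕ) (c : ℝ) (f : ℝ × ℤ → ℂ) :
    truncate n (c • f) = c • truncate n f := indicator_const_smul _ c f

lemma truncate_congr_ae (n : ℕ) {f g : ℝ × ℤ → ℂ} (h : f =ᵐ[dualMeasure] g) :
    truncate n f =ᵐ[dualMeasure] truncate n g := by
  filter_upwards [h] with p hp
  by_cases hb : p ∈ {p : ℝ × ℤ | |p.1| ≤ n ∧ |p.2| ≤ n}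
  · rw [truncate, truncate, indicator_of_mem hb, indicator_of_mem hb, hp]
  · rw [truncate, truncate, indicator_of_notMem hb, indicator_of_notMem hb]

lemma one_le_rpow_abs_mul_rpow {a A s : ℝ} (ha : 1 ≤ a) (hA : a ≤ A) : 1 ≤ A ^ |s| * a ^ s := by
  have ha0 : 0 < a := by linarith
  calc (1 : ℝ) ≤ a ^ (|s| + s) := Real.one_le_rpow ha (by linarith [neg_abs_le s])
    _ = a ^ |s| * a ^ s := Real.rpow_add ha0 _ _
    _ ≤ _ := by gcongr

/-- A bound for the inverse of the Sobolev weight on the box `|ξ|, |k| ≤ n`. -/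
def boxConst (s₁ s₂ : ℝ) (n : ℕ) : ℝ := (1 + (n : ℝ) ^ 2) ^ |s₁| * (1 + (n : ℝ) ^ 2) ^ |s₂|

lemma boxConst_nonneg (s₁ s₂ : ℝ) (n : ℕ) : 0 ≤ boxConst s₁ s₂ n := by unfold boxConst; positivity

lemma one_le_boxConst_mul_weight (s₁ s₂ : ℝ) {n : ℕ} {p : ℝ × ℤ}
    (hp : |p.1| ≤ n ∧ |p.2| ≤ n) : 1 ≤ boxConst s₁ s₂ n * weight s₁ s₂ p := by
  have h1 : p.1 ^ 2 ≤ (n : ℝ) ^ 2 := sq_le_sq.2 (by simpa using hp.1)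
  have h2 : (p.2 : ℝ) ^ 2 ≤ (n : ℝ) ^ 2 := by
    have : p.2 ^ 2 ≤ (n : ℤ) ^ 2 := sq_le_sq.2 (by simpa using hp.2)
    exact_mod_cast this
  rw [boxConst, weight, mul_mul_mul_comm]
  exact one_le_mul_of_one_le_of_one_le
    (one_le_rpow_abs_mul_rpow (by nlinarith [sq_nonneg p.1]) (by linarith))
    (one_le_rpow_abs_mul_rpow (by nlinarith [sq_nonneg (p.2 : ℝ)]) (by linarith))

variable {s₁ s₂ T : ℝ} {E : Submodule ℝ (Sobolev s₁ s₂)}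

lemma Sobolev.measurable (f : Sobolev s₁ s₂) : Measurable f := (Lp.stronglyMeasurable f).measurable

/-- On the box the weight is bounded below whatever the signs of `s₁` and `s₂`, so truncation maps
into `L²` and the truncated product has a bounded Fourier transform. -/
lemma lintegral_truncate_le (n : ℕ) (f : Sobolev s₁ s₂) :
    (∫⁻ p, ‖truncate n f p‖ₑ ^ (2 : ℝ) ∂dualMeasure) ^ (1 / (2 : ℝ)) ≤
      ENNReal.ofReal (boxConst s₁ s₂ n ^ (1 / 2 : ℝ) * ‖f‖) := by
  have hb := boxConst_nonneg s₁ s₂ n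
  rw [one_div, ENNReal.rpow_inv_le_iff (by norm_num), ENNReal.ofReal_mul (by positivity),
    ENNReal.mul_rpow_of_nonneg _ _ (by norm_num), ← lintegral_enorm_sq f,
    ENNReal.ofReal_rpow_of_nonneg (by positivity) (by norm_num), ← Real.rpow_mul hb,
    ← lintegral_const_mul' _ _ ENNReal.ofReal_ne_top]
  refine lintegral_mono fun p => ?_
  rw [← mul_assoc, ← ENNReal.ofReal_mul (by positivity)]
  by_cases hp : p ∈ {p : ℝ × ℤ | |p.1| ≤ n ∧ |p.2| ≤ n}
  · rw [truncate, indicator_of_mem hp]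
    refine le_mul_of_one_le_left' ?_
    rw [ENNReal.one_le_ofReal]
    norm_num
    exact one_le_boxConst_mul_weight s₁ s₂ hp
  · rw [truncate, indicator_of_notMem hp]
    simp

lemma lintegral_conv_truncate_le (n : ℕ) (f g : Sobolev s₁ s₂) (p : ℝ × ℤ) :
    ∫⁻ q, ‖truncate n f q * truncate n g (p - q)‖ₑ ∂dualMeasure ≤
      ENNReal.ofReal (boxConst s₁ s₂ n * ‖f‖ * ‖g‖) := by
  refine (lintegral_conv_le (measurable_truncate n f.measurable)
    (measurable_truncate n g.measurable) p).trans ?_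
  refine (mul_le_mul' (lintegral_truncate_le n f) (lintegral_truncate_le n g)).trans_eq ?_
  have hb := boxConst_nonneg s₁ s₂ n
  rw [← ENNReal.ofReal_mul (by positivity), mul_mul_mul_comm, ← Real.rpow_add_of_nonneg hb
    (by norm_num) (by norm_num), mul_assoc]
  norm_num

lemma integrable_conv_truncate (n : ℕ) (f g : Sobolev s₁ s₂) (p : ℝ × ℤ) :
    Integrable (fun q => truncate n f q * truncate n g (p - q)) dualMeasure :=
  ⟨((measurable_truncate n f.measurable).mul ((measurable_truncate n g.measurable).comp
    (measurePreserving_const_sub p).measurable)).aestronglyMeasurable,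
    (lintegral_conv_truncate_le n f g p).trans_lt ENNReal.ofReal_lt_top⟩

lemma norm_conv_truncate_le (n : ℕ) (f g : Sobolev s₁ s₂) (p : ℝ × ℤ) :
    ‖conv (truncate n f) (truncate n g) p‖ ≤ boxConst s₁ s₂ n * ‖f‖ * ‖g‖ := by
  have hb := boxConst_nonneg s₁ s₂ n
  rw [← ENNReal.ofReal_le_ofReal_iff (by positivity), ofReal_norm]
  exact (enorm_integral_le_lintegral_enorm _).trans (lintegral_conv_truncate_le n f g p)

/-- The value at `p` of the Fourier transform of the product of two truncated functions. -/
def truncConv (s₁ s₂ : ℝ) (n : ℕ) (p : ℝ × ℤ) : Sobolev s₁ s₂ →L[ℝ] Sobolev s₁ s₂ →L[ℝ] ℂ :=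
  LinearMap.mkContinuous₂
    (LinearMap.mk₂ ℝ (fun f g : Sobolev s₁ s₂ => conv (truncate n f) (truncate n g) p)
      (fun f f' g => by
        rw [conv_congr_ae (truncate_congr_ae n (ae_sobolevMeasure_iff.1 (Lp.coeFn_add f f')))
          (ae_eq_refl _), truncate_add, conv, conv, conv,
          ← integral_add (integrable_conv_truncate n f g p) (integrable_conv_truncate n f' g p)]
        exact integral_congr_ae (Eventually.of_forall fun q => add_mul _ _ _))
      (fun c f g => by
        rw [conv_congr_ae (truncate_congr_ae n (ae_sobolevMeasure_iff.1 (Lp.coeFn_smul c f)))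
          (ae_eq_refl _), truncate_smul, conv, conv, ← integral_smul]
        exact integral_congr_ae (Eventually.of_forall fun q => smul_mul_assoc c (truncate n f q) _))
      (fun f g g' => by
        rw [conv_congr_ae (ae_eq_refl _)
          (truncate_congr_ae n (ae_sobolevMeasure_iff.1 (Lp.coeFn_add g g'))), truncate_add,
          conv, conv, conv,
          ← integral_add (integrable_conv_truncate n f g p) (integrable_conv_truncate n f g' p)]
        exact integral_congr_ae (Eventually.of_forall fun q => mul_add _ _ _))
      (fun c f g => by
        rw [conv_congr_ae (ae_eq_refl _)
          (truncate_congr_ae n (ae_sobolevMeasure_iff.1 (Lp.coeFn_smul c g))), truncate_smul,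
          conv, conv, ← integral_smul]
        exact integral_congr_ae (Eventually.of_forall fun q => mul_smul_comm c _ (truncate n g (p - q)))))
    (boxConst s₁ s₂ n) (fun f g => norm_conv_truncate_le n f g p)

lemma truncConv_apply (n : ℕ) (p : ℝ × ℤ) (f g : Sobolev s₁ s₂) :
    truncConv s₁ s₂ n p f g = conv (truncate n f) (truncate n g) p := rfl

lemma integrable_mul_truncConv (n : ℕ) (k : ℤ) {m : ℝ → ℂ} (hm : Integrable m)
    (f g : Sobolev s₁ s₂) : Integrable fun ξ : ℝ => m ξ * truncConv s₁ s₂ n (ξ, k) f g := by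
  refine hm.mul_bdd (c := boxConst s₁ s₂ n * ‖f‖ * ‖g‖) ?_
    (Eventually.of_forall fun ξ => norm_conv_truncate_le n f g (ξ, k))
  exact ((measurable_conv (measurable_truncate n f.measurable)
    (measurable_truncate n g.measurable)).comp measurable_prodMk_right).aestronglyMeasurable

lemma norm_integral_mul_truncConv_le (n : ℕ) (k : ℤ) {m : ℝ → ℂ} (hm : Integrable m)
    (f g : Sobolev s₁ s₂) : ‖∫ ξ : ℝ, m ξ * truncConv s₁ s₂ n (ξ, k) f g‖ ≤
      boxConst s₁ s₂ n * (∫ ξ, ‖m ξ‖) * ‖f‖ * ‖g‖ := by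
  rw [show boxConst s₁ s₂ n * (∫ ξ, ‖m ξ‖) * ‖f‖ * ‖g‖ =
    ∫ ξ, ‖m ξ‖ * (boxConst s₁ s₂ n * ‖f‖ * ‖g‖) by rw [integral_mul_const]; ring]
  refine norm_integral_le_of_norm_le (hm.norm.mul_const _) (Eventually.of_forall fun ξ => ?_)
  rw [norm_mul]
  exact mul_le_mul_of_nonneg_left (norm_conv_truncate_le n f g (ξ, k)) (norm_nonneg _)

/-- The `k`-th mode of the product of two truncated functions, tested against `m`. -/
def modeForm (s₁ s₂ : ℝ) (n : ℕ) (k : ℤ) (m : ℝ → ℂ) (hm : Integrable m) :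
    Sobolev s₁ s₂ →L[ℝ] Sobolev s₁ s₂ →L[ℝ] ℂ :=
  LinearMap.mkContinuous₂
    (LinearMap.mk₂ ℝ (fun f g : Sobolev s₁ s₂ => ∫ ξ : ℝ, m ξ * truncConv s₁ s₂ n (ξ, k) f g)
      (fun f f' g => by
        simp_rw [map_add, add_apply, mul_add]
        exact integral_add (integrable_mul_truncConv n k hm f g)
          (integrable_mul_truncConv n k hm f' g))
      (fun c f g => by
        simp_rw [map_smul, smul_apply, mul_smul_comm]
        exact integral_smul _ _)
      (fun f g g' => by
        simp_rw [map_add, mul_add]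
        exact integral_add (integrable_mul_truncConv n k hm f g)
          (integrable_mul_truncConv n k hm f g'))
      (fun c f g => by
        simp_rw [map_smul, mul_smul_comm]
        exact integral_smul _ _))
    (boxConst s₁ s₂ n * (∫ ξ, ‖m ξ‖)) (fun f g => norm_integral_mul_truncConv_le n k hm f g)

lemma modeForm_apply (n : ℕ) (k : ℤ) {m : ℝ → ℂ} (hm : Integrable m) (f g : Sobolev s₁ s₂) :
    modeForm s₁ s₂ n k m hm f g =
      ∫ ξ : ℝ, m ξ * conv (truncate n f) (truncate n g) (ξ, k) := rfl

lemma norm_modeForm_le (n : ℕ) (k : ℤ) {m : ℝ → ℂ} (hm : Integrable m) :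
    ‖modeForm s₁ s₂ n k m hm‖ ≤ boxConst s₁ s₂ n * ∫ ξ, ‖m ξ‖ :=
  LinearMap.mkContinuous₂_norm_le _
    (mul_nonneg (boxConst_nonneg s₁ s₂ n) (integral_nonneg fun _ => norm_nonneg _)) _

lemma modeForm_sub (n : ℕ) (k : ℤ) {m m' : ℝ → ℂ} (hm : Integrable m) (hm' : Integrable m') :
    modeForm s₁ s₂ n k m hm - modeForm s₁ s₂ n k m' hm' =
      modeForm s₁ s₂ n k (m - m') (hm.sub hm') := by
  ext f g
  simp only [sub_apply, modeForm_apply, Pi.sub_apply, sub_mul]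
  exact (integral_sub (integrable_mul_truncConv n k hm f g)
    (integrable_mul_truncConv n k hm' f g)).symm

/-! ### The oscillating Duhamel multiplier and its continuity in time. -/

lemma measurable_dispersion (α : ℝ) (k : ℤ) : Measurable fun ξ : ℝ => dispersion α ξ k :=
  (measurable_id.mul (measurable_id.abs.pow_const α)).add (measurable_const.div measurable_id)

/-- The multiplier `e^{-isω} iξ ψ`. -/
def duhamelMultiplier (α : ℝ) (k : ℤ) (ψ : ℝ → ℂ) (s ξ : ℝ) : ℂ :=
  Complex.exp (-(Complex.I * (s * dispersion α ξ k : ℝ))) * (Complex.I * ξ * ψ ξ)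

lemma norm_exp_neg_I_mul (x : ℝ) : ‖Complex.exp (-(Complex.I * (x : ℝ)))‖ = 1 := by
  rw [mul_comm, ← neg_mul, ← Complex.ofReal_neg, Complex.norm_exp_ofReal_mul_I]

lemma norm_duhamelMultiplier (α : ℝ) (k : ℤ) (ψ : ℝ → ℂ) (s ξ : ℝ) :
    ‖duhamelMultiplier α k ψ s ξ‖ = ‖Complex.I * ξ * ψ ξ‖ := by
  rw [duhamelMultiplier, norm_mul, norm_exp_neg_I_mul, one_mul]

lemma measurable_phase (α : ℝ) (k : ℤ) (s : ℝ) :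
    Measurable fun ξ : ℝ => Complex.exp (-(Complex.I * (s * dispersion α ξ k : ℝ))) :=
  Complex.measurable_exp.comp ((Complex.measurable_ofReal.comp
    ((measurable_dispersion α k).const_mul s)).const_mul _).neg

lemma IsTest.integrable_I_mul {ψ : ℝ → ℂ} (h : IsTest ψ) :
    Integrable fun ξ : ℝ => Complex.I * ξ * ψ ξ := by
  have hc := h.smooth.continuous
  exact (by fun_prop : Continuous fun ξ : ℝ => Complex.I * ξ * ψ ξ).integrable_of_hasCompactSupport
    h.compact.mul_left

lemma IsTest.integrable_duhamelMultiplier {ψ : ℝ → ℂ} (h : IsTest ψ) (α : ℝ) (k : ℤ) (s : ℝ) :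
    Integrable (duhamelMultiplier α k ψ s) :=
  h.integrable_I_mul.bdd_mul (c := 1) (measurable_phase α k s).aestronglyMeasurable
    (Eventually.of_forall fun _ => (norm_exp_neg_I_mul _).le)

lemma continuous_of_norm_sub_le {Y F : Type*} [TopologicalSpace Y] [SeminormedAddCommGroup F]
    {f : Y → F} {g : Y → Y → ℝ} (hg : ∀ x, Continuous (g x)) (h0 : ∀ x, g x x = 0)
    (h : ∀ x y, ‖f y - f x‖ ≤ g x y) : Continuous f := by
  rw [continuous_iff_continuousAt]
  intro x
  refine tendsto_iff_norm_sub_tendsto_zero.2 (squeeze_zero (fun _ => norm_nonneg _) (h x) ?_)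
  simpa [h0 x] using (hg x).tendsto x

/-- The operator norm of a difference is controlled by the `L¹` norm of the difference of the
multipliers, which tends to zero by dominated convergence because the phases have modulus one. This
makes the Duhamel integrand continuous in time along any continuous curve. -/
lemma continuous_modeForm (s₁ s₂ α : ℝ) (n : ℕ) (k : ℤ) {ψ : ℝ → ℂ} (h : IsTest ψ) :
    Continuous fun s => modeForm s₁ s₂ n k (duhamelMultiplier α k ψ s)
      (h.integrable_duhamelMultiplier α k s) := by
  refine continuous_of_norm_sub_le (F := Sobolev s₁ s₂ →L[ℝ] Sobolev s₁ s₂ →L[ℝ] ℂ)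
    (g := fun s₀ s => boxConst s₁ s₂ n *
    ∫ ξ, ‖(duhamelMultiplier α k ψ s - duhamelMultiplier α k ψ s₀) ξ‖) (fun s₀ => ?_)
    (fun s₀ => by simp) fun s₀ s => ?_
  swap
  · rw [modeForm_sub]
    exact norm_modeForm_le n k _
  have hc : Continuous fun s => ∫ ξ, ‖(duhamelMultiplier α k ψ s - duhamelMultiplier α k ψ s₀) ξ‖ := by
    refine continuous_of_dominated (bound := fun ξ => 2 * ‖Complex.I * ξ * ψ ξ‖)
      (fun s => ?_) (fun s => Eventually.of_forall fun ξ => ?_)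
      (h.integrable_I_mul.norm.const_mul 2) (Eventually.of_forall fun ξ => ?_)
    · exact ((h.integrable_duhamelMultiplier α k s).sub
        (h.integrable_duhamelMultiplier α k s₀)).norm.aestronglyMeasurable
    · rw [norm_norm, Pi.sub_apply, two_mul]
      nth_rw 1 [← norm_duhamelMultiplier α k ψ s ξ]
      rw [← norm_duhamelMultiplier α k ψ s₀ ξ]
      exact norm_sub_le _ _
    · simp only [Pi.sub_apply, duhamelMultiplier]
      fun_prop
  exact hc.const_mul _

end

section

/-! ### Limits of quadratic forms on a Banach space, and Taylor's formula. -/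

section QuadraticForms

variable {X : Type*} [NormedAddCommGroup X] [NormedSpace ℝ X]

/-- Polarised uniform boundedness for a pointwise convergent sequence of quadratic forms. -/
lemma exists_polar_bound [CompleteSpace X] (B : ℕ → X →L[ℝ] X →L[ℝ] ℂ) {Q : X → ℂ}
    (hB : ∀ u, Tendsto (fun n => B n u u) atTop (𝓝 (Q u))) :
    ∃ C, 0 ≤ C ∧ ∀ n u v, ‖B n u v + B n v u‖ ≤ C * ‖u‖ * ‖v‖ := by
  -- Only the diagonal values converge, so polarisation bounds the symmetrised forms pointwise.
  -- Uniform boundedness is then applied twice, in `v` for fixed `u` and then in `u`.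
  have h1 : ∀ u v, ∃ C, ∀ n, ‖(B n + (B n).flip) u v‖ ≤ C := fun u v => by
    have h := (((hB (u + v)).sub (hB u)).sub (hB v)).norm.bddAbove_range
    obtain ⟨C, hC⟩ := h
    refine ⟨C, fun n => ?_⟩
    have := hC ⟨n, rfl⟩
    simp only [map_add, add_apply] at this
    refine le_of_eq_of_le ?_ this
    simp only [add_apply, ContinuousLinearMap.flip_apply]
    congr 1
    ring
  have h2 : ∀ u, ∃ C, ∀ n, ‖(B n + (B n).flip) u‖ ≤ C := fun u => banach_steinhaus (h1 u)
  obtain ⟨C, hC⟩ := banach_steinhaus h2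
  refine ⟨C, (norm_nonneg _).trans (hC 0), fun n u v => ?_⟩
  exact ((B n + (B n).flip).le_opNorm₂ u v).trans (by gcongr; exact hC n)

/-- The polar bound is uniform in `n`, so it gives a local Lipschitz estimate that survives the
limit. -/
lemma continuous_of_tendsto_quadratic [CompleteSpace X] (B : ℕ → X →L[ℝ] X →L[ℝ] ℂ) {Q : X → ℂ}
    (hB : ∀ u, Tendsto (fun n => B n u u) atTop (𝓝 (Q u))) : Continuous Q := by
  obtain ⟨C, -, hC⟩ := exists_polar_bound B hB
  rw [continuous_iff_continuousAt]
  intro u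
  have hbound : ∀ v, ‖Q v - Q u‖ ≤ C * ‖u‖ * ‖v - u‖ + C * ‖v - u‖ * ‖v - u‖ := fun v => by
    refine le_of_tendsto ((hB v).sub (hB u)).norm (Eventually.of_forall fun n => ?_)
    -- The difference is expressed through symmetrised values only; the factor `1/2` halves the
    -- symmetrised diagonal term.
    have h1 : B n v v - B n u u =
        (B n u (v - u) + B n (v - u) u) + (1 / 2 : ℝ) • (B n (v - u) (v - u) + B n (v - u) (v - u)) := by
      simp only [map_sub, sub_apply, Complex.real_smul]
      push_cast
      ring
    rw [h1]
    refine (norm_add_le _ _).trans (add_le_add (hC n u (v - u)) ?_)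
    rw [norm_smul]
    refine le_trans (mul_le_of_le_one_left (norm_nonneg _) (by norm_num)) (hC n _ _)
  have hlim : Tendsto (fun v => C * ‖u‖ * ‖v - u‖ + C * ‖v - u‖ * ‖v - u‖) (𝓝 u) (𝓝 0) := by
    have : Continuous fun v => C * ‖u‖ * ‖v - u‖ + C * ‖v - u‖ * ‖v - u‖ := by fun_prop
    simpa using this.tendsto u
  exact tendsto_iff_norm_sub_tendsto_zero.2 (squeeze_zero (fun _ => norm_nonneg _) hbound hlim)

lemma smul_of_tendsto_quadratic (B : ℕ → X →L[ℝ] X →L[ℝ] ℂ) {Q : X → ℂ}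
    (hB : ∀ u, Tendsto (fun n => B n u u) atTop (𝓝 (Q u))) (c : ℝ) (u : X) :
    Q (c • u) = (c ^ 2) • Q u := by
  refine tendsto_nhds_unique (hB (c • u)) (((hB u).const_smul (c ^ 2)).congr fun n => ?_)
  simp only [map_smul, smul_apply, smul_smul, sq]

/-- By homogeneity the expression is `Q (φ ε / ε)`. The difference quotients must converge in `X`,
since that is where `Q` is known to be continuous. -/
lemma tendsto_quadratic_curve [CompleteSpace X] (B : ℕ → X →L[ℝ] X →L[ℝ] ℂ) {Q : X → ℂ}
    (hB : ∀ u, Tendsto (fun n => B n u u) atTop (𝓝 (Q u))) {φ : ℝ → X} {v : X}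
    (hφ : HasDerivAt φ v 0) (h0 : φ 0 = 0) :
    Tendsto (fun ε : ℝ => (ε⁻¹ ^ 2) • Q (φ ε)) (𝓝[≠] 0) (𝓝 (Q v)) := by
  have h := ((continuous_of_tendsto_quadratic B hB).tendsto v).comp hφ.tendsto_slope
  refine h.congr fun ε => ?_
  rw [Function.comp_apply, slope_def_module, h0, sub_zero, sub_zero,
    smul_of_tendsto_quadratic B hB]

/-- Second order Taylor bound for a map of class `C²`. -/
lemma exists_taylor_bound {F G : Type*} [NormedAddCommGroup F] [NormedSpace ℝ F]
    [NormedAddCommGroup G] [NormedSpace ℝ G] {f : F → G} (hf : ContDiffAt ℝ 2 f 0) :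
    ∃ C, 0 ≤ C ∧ ∀ᶠ x in 𝓝 (0 : F), ‖f x - f 0 - fderiv ℝ f 0 x‖ ≤ C * ‖x‖ ^ 2 := by
  obtain ⟨K, s, hs, hK⟩ :=
    (hf.fderiv_right (m := 1) (by norm_num)).exists_lipschitzOnWith
  have hd : ∀ᶠ x in 𝓝 (0 : F), DifferentiableAt ℝ f x :=
    (hf.eventually (by simp)).mono fun x hx => hx.differentiableAt (by norm_num)
  obtain ⟨r, hr, hball⟩ := Metric.mem_nhds_iff.1 (inter_mem hs hd)
  refine ⟨K, K.2, Filter.mem_of_superset (Metric.ball_mem_nhds 0 hr) fun x hx => ?_⟩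
  have hsub : Metric.closedBall (0 : F) ‖x‖ ⊆ Metric.ball 0 r :=
    Metric.closedBall_subset_ball (by simpa using hx)
  -- Mean value inequality on the ball of radius `‖x‖`, where the Lipschitz bound keeps the
  -- derivative within `K * ‖x‖` of its value at `0`.
  have h := (convex_closedBall (0 : F) ‖x‖).norm_image_sub_le_of_norm_hasFDerivWithin_le'
    (f := f) (f' := fderiv ℝ f) (φ := fderiv ℝ f 0) (C := K * ‖x‖) (x := 0) (y := x)
    (fun z hz => (hball (hsub hz)).2.hasFDerivAt.hasFDerivWithinAt)
    (fun z hz => by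
      have h1 := hK.norm_sub_le (hball (hsub hz)).1 (hball (Metric.mem_ball_self hr)).1
      refine h1.trans ?_
      gcongr
      simpa using hz)
    (by simp) (by simp)
  rw [sub_zero] at h
  exact h.trans_eq (by ring)

end QuadraticForms

/-! ### The truncated Duhamel integral as a bounded bilinear form on curves. -/

variable {s₁ s₂ T : ℝ} {E : Submodule ℝ (Sobolev s₁ s₂)}

/-- The value of a curve at time `s`, continued by constants. -/
def curveValue (hT : 0 < T) (u : C(Icc (-T) T, E)) (s : ℝ) : Sobolev s₁ s₂ :=
  (u (projIcc (-T) T (by linarith) s) : E)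

lemma curve_eq (hT : 0 < T) (u : C(Icc (-T) T, E)) (s : ℝ) :
    curve hT u s = curveValue hT u s := rfl

lemma continuous_curveValue (hT : 0 < T) (u : C(Icc (-T) T, E)) :
    Continuous (curveValue hT u) :=
  continuous_subtype_val.comp (u.continuous.comp continuous_projIcc)

lemma norm_curveValue_le (hT : 0 < T) (u : C(Icc (-T) T, E)) (s : ℝ) :
    ‖curveValue hT u s‖ ≤ ‖u‖ := u.norm_coe_le_norm _

lemma continuous_modeForm_curveValue (α : ℝ) (hT : 0 < T) (n : ℕ) (k : ℤ) {ψ : ℝ → ℂ}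
    (h : IsTest ψ) (u v : C(Icc (-T) T, E)) :
    Continuous fun s => modeForm s₁ s₂ n k (duhamelMultiplier α k ψ s)
      (h.integrable_duhamelMultiplier α k s) (curveValue hT u s) (curveValue hT v s) :=
  ((continuous_modeForm s₁ s₂ α n k h).clm_apply (continuous_curveValue hT u)).clm_apply
    (continuous_curveValue hT v)

lemma norm_integral_modeForm_le (α : ℝ) (hT : 0 < T) (n : ℕ) (k : ℤ) {ψ : ℝ → ℂ}
    (h : IsTest ψ) (t : ℝ) (u v : C(Icc (-T) T, E)) :
    ‖∫ s in (0 : ℝ)..t, modeForm s₁ s₂ n k (duhamelMultiplier α k ψ s)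
      (h.integrable_duhamelMultiplier α k s) (curveValue hT u s) (curveValue hT v s)‖ ≤
      boxConst s₁ s₂ n * (∫ ξ, ‖Complex.I * ξ * ψ ξ‖) * |t| * ‖u‖ * ‖v‖ := by
  have hb : 0 ≤ boxConst s₁ s₂ n * ∫ ξ, ‖Complex.I * ξ * ψ ξ‖ :=
    mul_nonneg (boxConst_nonneg s₁ s₂ n) (integral_nonneg fun _ => norm_nonneg _)
  have := intervalIntegral.norm_integral_le_of_norm_le_const (a := 0) (b := t)
    (C := boxConst s₁ s₂ n * (∫ ξ, ‖Complex.I * ξ * ψ ξ‖) * ‖u‖ * ‖v‖)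
    (f := fun s => modeForm s₁ s₂ n k (duhamelMultiplier α k ψ s)
      (h.integrable_duhamelMultiplier α k s) (curveValue hT u s) (curveValue hT v s))
    fun s _ => by
      refine (ContinuousLinearMap.le_opNorm₂ _ _ _).trans ?_
      have h1 := norm_modeForm_le (s₁ := s₁) (s₂ := s₂) n k
        (h.integrable_duhamelMultiplier α k s)
      simp_rw [norm_duhamelMultiplier] at h1
      gcongr
      · exact norm_curveValue_le hT u s
      · exact norm_curveValue_le hT v s
  rw [sub_zero] at this
  exact this.trans_eq (by ring)

/-- The truncated Duhamel integral as a bounded bilinear form on curves. -/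
def duhamelForm (E : Submodule ℝ (Sobolev s₁ s₂)) (α : ℝ) (hT : 0 < T) (t : ℝ) (k : ℤ) {ψ : ℝ → ℂ}
    (h : IsTest ψ) (n : ℕ) :
    C(Icc (-T) T, E) →L[ℝ] C(Icc (-T) T, E) →L[ℝ] ℂ :=
  LinearMap.mkContinuous₂
    (LinearMap.mk₂ ℝ (fun u v : C(Icc (-T) T, E) => ∫ s in (0 : ℝ)..t,
        modeForm s₁ s₂ n k (duhamelMultiplier α k ψ s)
          (h.integrable_duhamelMultiplier α k s) (curveValue hT u s) (curveValue hT v s))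
      (fun u u' v => by
        rw [← intervalIntegral.integral_add
          ((continuous_modeForm_curveValue α hT n k h u v).intervalIntegrable _ _)
          ((continuous_modeForm_curveValue α hT n k h u' v).intervalIntegrable _ _)]
        refine intervalIntegral.integral_congr fun s _ => ?_
        have h1 : curveValue hT (u + u') s = curveValue hT u s + curveValue hT u' s := rfl
        simp only [h1, map_add, add_apply])
      (fun c u v => by
        rw [← intervalIntegral.integral_smul]
        refine intervalIntegral.integral_congr fun s _ => ?_
        have h1 : curveValue hT (c • u) s = c • curveValue hT u s := rfl
        simp only [h1, map_smul, smul_apply])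
      (fun u v v' => by
        rw [← intervalIntegral.integral_add
          ((continuous_modeForm_curveValue α hT n k h u v).intervalIntegrable _ _)
          ((continuous_modeForm_curveValue α hT n k h u v').intervalIntegrable _ _)]
        refine intervalIntegral.integral_congr fun s _ => ?_
        have h1 : curveValue hT (v + v') s = curveValue hT v s + curveValue hT v' s := rfl
        simp only [h1, map_add])
      (fun c u v => by
        rw [← intervalIntegral.integral_smul]
        refine intervalIntegral.integral_congr fun s _ => ?_
        have h1 : curveValue hT (c • v) s = c • curveValue hT v s := rfl
        simp only [h1, map_smul]))
    (boxConst s₁ s₂ n * (∫ ξ, ‖Complex.I * ξ * ψ ξ‖) * |t|)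
    (fun u v => norm_integral_modeForm_le α hT n k h t u v)

lemma duhamelForm_apply (α : ℝ) (hT : 0 < T) (t : ℝ) (k : ℤ) {ψ : ℝ → ℂ}
    (h : IsTest ψ) (n : ℕ) (u v : C(Icc (-T) T, E)) :
    duhamelForm E α hT t k h n u v = ∫ s in (0 : ℝ)..t,
      modeForm s₁ s₂ n k (duhamelMultiplier α k ψ s)
        (h.integrable_duhamelMultiplier α k s) (curveValue hT u s) (curveValue hT v s) := rfl

lemma duhamelApprox_curve (α : ℝ) (hT : 0 < T) (t : ℝ) (k : ℤ) {ψ : ℝ → ℂ}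
    (h : IsTest ψ) (n : ℕ) (u : C(Icc (-T) T, E)) :
    duhamelApprox α (curve hT u) t k ψ n = duhamelForm E α hT t k h n u u := by
  rw [duhamelForm_apply, duhamelApprox]
  refine intervalIntegral.integral_congr fun s _ => ?_
  simp only [modeForm_apply, curve_eq]
  refine integral_congr_ae (Eventually.of_forall fun ξ => ?_)
  simp only [duhamelMultiplier]
  ring

end

/-! ### Testing the propagator, and identification of the linear evolution. -/

section

variable {s₁ s₂ T : ℝ} {E : Submodule ℝ (Sobolev s₁ s₂)}

/-- The test function `e^{-itω} ψ`. -/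
def twist (α t : ℝ) (k : ℤ) (ψ : ℝ → ℂ) (ξ : ℝ) : ℂ :=
  Complex.exp (-(Complex.I * (t * dispersion α ξ k : ℝ))) * ψ ξ

lemma IsTest.measurable {ψ : ℝ → ℂ} (h : IsTest ψ) : Measurable ψ := h.smooth.continuous.measurable

lemma IsTest.measurable_twist {ψ : ℝ → ℂ} (h : IsTest ψ) (α t : ℝ) (k : ℤ) :
    Measurable (twist α t k ψ) := (measurable_phase α k t).mul h.measurable

lemma dualNorm_twist (α t : ℝ) (k : ℤ) (ψ : ℝ → ℂ) :
    dualNorm s₁ s₂ k (twist α t k ψ) = dualNorm s₁ s₂ k ψ :=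
  dualNorm_congr fun ξ => by rw [twist, norm_mul, norm_exp_neg_I_mul, one_mul]

lemma IsTest.dualNorm_twist_ne_top {ψ : ℝ → ℂ} (h : IsTest ψ) (s₁ s₂ α t : ℝ) (k : ℤ) :
    dualNorm s₁ s₂ k (twist α t k ψ) ≠ ⊤ := by
  rw [dualNorm_twist]
  exact h.dualNorm_ne_top s₁ s₂ k

/-- The functional `f ↦ ⟨S(-t) f, ψ⟩` on the `k`-th mode. -/
def twistPairing (s₁ s₂ α t : ℝ) (k : ℤ) {ψ : ℝ → ℂ} (h : IsTest ψ) : Sobolev s₁ s₂ →L[ℝ] ℂ :=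
  pairing k (twist α t k ψ) (h.measurable_twist α t k) (h.dualNorm_twist_ne_top s₁ s₂ α t k)

lemma twistPairing_apply (α t : ℝ) (k : ℤ) {ψ : ℝ → ℂ} (h : IsTest ψ) (f : Sobolev s₁ s₂) :
    twistPairing s₁ s₂ α t k h f = ∫ ξ : ℝ, twist α t k ψ ξ * f (ξ, k) := rfl

lemma norm_twistPairing_le (α t : ℝ) (k : ℤ) {ψ : ℝ → ℂ} (h : IsTest ψ) (f : Sobolev s₁ s₂) :
    ‖twistPairing s₁ s₂ α t k h f‖ ≤ (dualNorm s₁ s₂ k ψ).toReal * ‖f‖ := by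
  rw [← dualNorm_twist α t k ψ]
  exact norm_pairing_le (h.measurable_twist α t k) (h.dualNorm_twist_ne_top s₁ s₂ α t k) f

lemma integral_sub_mul_test (α t : ℝ) (k : ℤ) {ψ : ℝ → ℂ} (h : IsTest ψ) (f g : Sobolev s₁ s₂) :
    ∫ ξ : ℝ, (Complex.exp (-(Complex.I * (t * dispersion α ξ k : ℝ))) * f (ξ, k) - g (ξ, k)) * ψ ξ =
      twistPairing s₁ s₂ α t k h f - twistPairing s₁ s₂ α 0 k h g := by
  rw [twistPairing_apply, twistPairing_apply, ← integral_sub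
    (integrable_pairing (h.measurable_twist α t k) (h.dualNorm_twist_ne_top s₁ s₂ α t k) f)
    (integrable_pairing (h.measurable_twist α 0 k) (h.dualNorm_twist_ne_top s₁ s₂ α 0 k) g)]
  refine integral_congr_ae (Eventually.of_forall fun ξ => ?_)
  simp only [twist, zero_mul, Complex.ofReal_zero, mul_zero, neg_zero, Complex.exp_zero]
  ring

/-- The slice is paired with the indicator of a compact set, whose dual norm is finite because the
weight is bounded below there. The fundamental lemma of the calculus of variations requires this. -/
lemma locallyIntegrable_slice (f : Sobolev s₁ s₂) (k : ℤ) :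
    LocallyIntegrable fun ξ : ℝ => f (ξ, k) := by
  rw [locallyIntegrable_iff]
  intro K hK
  have hw : Continuous fun ξ : ℝ => 1 / weight s₁ s₂ (ξ, k) := by
    refine continuous_const.div ?_ fun ξ => (weight_pos s₁ s₂ _).ne'
    unfold weight
    refine Continuous.mul (Continuous.rpow_const (by fun_prop) fun ξ => Or.inl ?_)
      (continuous_const (y := (1 + (k : ℝ) ^ 2) ^ s₂))
    positivity
  obtain ⟨B, hB⟩ := hK.bddAbove_image (hw.continuousOn (s := K))
  have hm : Measurable (K.indicator fun _ => (1 : ℂ)) :=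
    measurable_const.indicator hK.isClosed.measurableSet
  have hd : dualNorm s₁ s₂ k (K.indicator fun _ => (1 : ℂ)) ≠ ⊤ := by
    refine ne_top_of_le_ne_top ?_ (dualNorm_le (A := K) (B := B)
      hK.isClosed.measurableSet (fun ξ hξ => indicator_of_notMem hξ _)
      fun ξ hξ => ?_)
    · exact ENNReal.rpow_ne_top_of_nonneg (by norm_num)
        (ENNReal.mul_ne_top ENNReal.ofReal_ne_top hK.measure_lt_top.ne)
    · rw [indicator_of_mem hξ, norm_one, one_pow]
      exact (div_le_iff₀ (weight_pos s₁ s₂ _)).1 (hB ⟨ξ, hξ, rfl⟩)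
  rw [← integrable_indicator_iff hK.isClosed.measurableSet]
  refine (integrable_pairing hm hd f).congr (Eventually.of_forall fun ξ => ?_)
  by_cases hξ : ξ ∈ K <;> simp [hξ]

lemma isTest_ofReal {g : ℝ → ℝ} (hg : ContDiff ℝ ∞ g) (hc : HasCompactSupport g)
    (h0 : (0 : ℝ) ∉ tsupport g) : IsTest fun ξ => (g ξ : ℂ) where
  smooth := Complex.ofRealCLM.contDiff.comp hg
  compact := hc.comp_left (g := fun x : ℝ => (x : ℂ)) Complex.ofReal_zero
  away h := h0 (tsupport_comp_subset (g := fun x : ℝ => (x : ℂ)) Complex.ofReal_zero g h)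

lemma exp_mul_exp_neg (x : ℝ) :
    Complex.exp (Complex.I * (x : ℝ)) * Complex.exp (-(Complex.I * (x : ℝ))) = 1 := by
  rw [← Complex.exp_add, add_neg_cancel, Complex.exp_zero]

/-- Distributional identification of a solution of the linear equation. -/
lemma ae_eq_propagator {α t : ℝ} {f g : Sobolev s₁ s₂}
    (H : ∀ (k : ℤ) (ψ : ℝ → ℂ) (h : IsTest ψ),
      twistPairing s₁ s₂ α t k h f = twistPairing s₁ s₂ α 0 k h g) :
    ∀ᵐ p ∂dualMeasure,
      f p = Complex.exp (Complex.I * (t * dispersion α p.1 p.2 : ℝ)) * g p := by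
  refine ae_of_slice fun k => ?_
  have hloc : LocallyIntegrable fun ξ : ℝ =>
      Complex.exp (-(Complex.I * (t * dispersion α ξ k : ℝ))) * f (ξ, k) - g (ξ, k) := by
    refine LocallyIntegrable.sub ?_ (locallyIntegrable_slice g k)
    rw [locallyIntegrable_iff]
    intro K hK
    exact ((locallyIntegrable_slice f k).integrableOn_isCompact hK).bdd_mul (c := 1)
      (measurable_phase α k t).aestronglyMeasurable
      (Eventually.of_forall fun _ => (norm_exp_neg_I_mul _).le)
  -- The test functions only see `ℝ ∖ {0}`; the remaining point is null.
  have hz := (isOpen_compl_singleton (x := (0 : ℝ))).ae_eq_zero_of_integral_contDiff_smul_eq_zero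
    (hloc.locallyIntegrableOn _) fun ψ hψ hc hs => by
      have h : IsTest fun ξ => (ψ ξ : ℂ) := isTest_ofReal hψ hc fun h => hs h rfl
      have := integral_sub_mul_test α t k h f g
      rw [H, sub_self] at this
      rw [← this]
      refine integral_congr_ae (Eventually.of_forall fun ξ => ?_)
      simp only [Complex.real_smul]
      ring
  have h0 : ∀ᵐ ξ : ℝ, ξ ∈ ({0}ᶜ : Set ℝ) := compl_mem_ae_iff.2 (measure_singleton 0)
  filter_upwards [hz, h0] with ξ h1 h2
  rw [← sub_eq_zero.1 (h1 h2), ← mul_assoc, exp_mul_exp_neg, one_mul]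

lemma curveValue_of_mem (hT : 0 < T) (u : C(Icc (-T) T, E)) (t : Icc (-T) T) :
    curveValue hT u t = (u t : Sobolev s₁ s₂) := by
  rw [curveValue, projIcc_val]

lemma isSolution_zero (α : ℝ) (hT : 0 < T) :
    IsSolution α T (curve hT (0 : C(Icc (-T) T, E))) ((0 : E) : Sobolev s₁ s₂) := by
  intro t ht k ψ h
  have h1 : ∀ n, duhamelApprox α (curve hT (0 : C(Icc (-T) T, E))) t k ψ n = 0 := fun n => by
    rw [duhamelApprox_curve α hT t k h]
    simp
  have h2 : curveValue hT (0 : C(Icc (-T) T, E)) t = 0 := rfl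
  simp_rw [h1, curve_eq, integral_sub_mul_test α t k h, h2]
  simp

/-! ### First and second order expansion of the flow at zero. -/

section Linearisation

variable {α : ℝ} {hT : 0 < T} {X : Type u} [NormedAddCommGroup X] [NormedSpace ℝ X]
  {ι : X →L[ℝ] C(Icc (-T) T, E)} {V : Set E} {Φ : E → X}

/-- Uniqueness enters here: the zero curve solves the equation with zero datum. -/
lemma IsC2Flow.map_zero (hF : IsC2Flow α hT ι V Φ) : Φ 0 = 0 := by
  refine (hF.unique 0 hF.zero_mem 0 ?_).symm
  rw [_root_.map_zero]
  exact isSolution_zero α hT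

/-- The truncated Duhamel integrals as bounded bilinear forms on `X`. -/
def pullbackForm (ι : X →L[ℝ] C(Icc (-T) T, E)) (α : ℝ) (hT : 0 < T) (t : ℝ) (k : ℤ) {ψ : ℝ → ℂ}
    (h : IsTest ψ) (n : ℕ) : X →L[ℝ] X →L[ℝ] ℂ :=
  (duhamelForm E α hT t k h n).bilinearComp ι ι

lemma duhamelApprox_eq_pullbackForm (t : ℝ) (k : ℤ) {ψ : ℝ → ℂ} (h : IsTest ψ) (n : ℕ) (v : X) :
    duhamelApprox α (curve hT (ι v)) t k ψ n = pullbackForm ι α hT t k h n v v :=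
  duhamelApprox_curve α hT t k h n (ι v)

lemma IsC2Flow.hasDerivAt_line (hF : IsC2Flow α hT ι V Φ) (h : E) :
    HasDerivAt (fun ε : ℝ => Φ (ε • h)) (fderiv ℝ Φ 0 h) 0 := by
  have h1 : HasDerivAt (fun ε : ℝ => ε • h) h 0 := by
    simpa using (hasDerivAt_id (0 : ℝ)).smul_const h
  refine HasFDerivAt.comp_hasDerivAt (0 : ℝ) ?_ h1
  rw [zero_smul]
  exact hF.differentiableAt_zero.hasFDerivAt

lemma IsC2Flow.eventually_mem (hF : IsC2Flow α hT ι V Φ) (h : E) :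
    ∀ᶠ ε : ℝ in 𝓝[≠] 0, ε • h ∈ V := by
  have h1 : Tendsto (fun ε : ℝ => ε • h) (𝓝 0) (𝓝 0) := by
    have : Continuous fun ε : ℝ => ε • h := by fun_prop
    simpa using this.tendsto 0
  exact (h1.mono_left nhdsWithin_le_nhds).eventually (hF.isOpen.mem_nhds hF.zero_mem)

lemma IsC2Flow.duhamel_eq (hF : IsC2Flow α hT ι V Φ) {u₀ : E} (hu : u₀ ∈ V) (t : Icc (-T) T)
    (k : ℤ) {ψ : ℝ → ℂ} (h : IsTest ψ) {q : ℂ}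
    (hq : Tendsto (duhamelApprox α (curve hT (ι (Φ u₀))) t k ψ) atTop (𝓝 q)) :
    (1 / 2 : ℂ) * q = twistPairing s₁ s₂ α t k h (ι (Φ u₀) t : E) -
      twistPairing s₁ s₂ α 0 k h (u₀ : Sobolev s₁ s₂) := by
  have := hF.solution u₀ hu t t.2 k ψ h
  rw [curve_eq, curveValue_of_mem, integral_sub_mul_test α t k h] at this
  exact tendsto_nhds_unique (hq.const_mul _) this

/-- The Duhamel term along `ε • u₀` is `O(ε²)`, so it disappears after division by `ε`, and only the
linear terms of the equation survive as `ε → 0`. -/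
lemma IsC2Flow.linear_eq [CompleteSpace X] (hF : IsC2Flow α hT ι V Φ) (u₀ : E) (t : Icc (-T) T)
    (k : ℤ) {ψ : ℝ → ℂ} (h : IsTest ψ) :
    twistPairing s₁ s₂ α t k h (ι (fderiv ℝ Φ 0 u₀) t : E) =
      twistPairing s₁ s₂ α 0 k h (u₀ : Sobolev s₁ s₂) := by
  choose Q hQ using fun v : X => hF.hasDuhamel v t t.2 k ψ h
  have hQ' : ∀ v, Tendsto (fun n => pullbackForm ι α hT t k h n v v) atTop (𝓝 (Q v)) := fun v =>
    (hQ v).congr fun n => duhamelApprox_eq_pullbackForm t k h n v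
  have hd := hF.hasDerivAt_line u₀
  have hlim := tendsto_quadratic_curve _ hQ' hd (by rw [zero_smul, hF.map_zero])
  have hε : Tendsto (fun ε : ℝ => ε) (𝓝[≠] 0) (𝓝 0) := tendsto_id.mono_left nhdsWithin_le_nhds
  -- The Duhamel term divided by `ε` is written as `ε` times the convergent quantity `ε⁻² Q`, up to
  -- the factor `1/2`.
  have h1 := (hε.smul hlim).const_mul (1 / 2 : ℂ)
  rw [zero_smul, mul_zero] at h1
  set ℓ : X →L[ℝ] ℂ := (twistPairing s₁ s₂ α t k h).comp
    (E.subtypeL.comp ((ContinuousMap.evalCLM ℝ t).comp ι)) with hℓ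
  have h2 := (ℓ.hasFDerivAt.comp_hasDerivAt (0 : ℝ) hd).tendsto_slope
  have h3 := h2.sub_const (twistPairing s₁ s₂ α 0 k h (u₀ : Sobolev s₁ s₂))
  refine sub_eq_zero.1 (tendsto_nhds_unique h3 (h1.congr' ?_))
  filter_upwards [hF.eventually_mem u₀, self_mem_nhdsWithin] with ε hV hε0
  have hε0' : ε ≠ 0 := hε0
  have h4 := hF.duhamel_eq hV t k h (hQ _)
  have h5 : twistPairing s₁ s₂ α 0 k h ((ε • u₀ : E) : Sobolev s₁ s₂) =
      ε • twistPairing s₁ s₂ α 0 k h (u₀ : Sobolev s₁ s₂) := by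
    rw [Submodule.coe_smul, map_smul]
  have h6 : (ℓ ∘ fun ε : ℝ => Φ (ε • u₀)) ε = twistPairing s₁ s₂ α t k h (ι (Φ (ε • u₀)) t : E) :=
    rfl
  have h7 : (ℓ ∘ fun ε : ℝ => Φ (ε • u₀)) 0 = 0 := by
    simp [hF.map_zero]
  rw [slope_def_module, h6, h7, sub_zero, sub_zero, smul_smul, mul_smul_comm, h4, h5, smul_sub,
    smul_smul]
  have e1 : ε * ε⁻¹ ^ 2 = ε⁻¹ := by field_simp
  have e2 : ε * ε⁻¹ ^ 2 * ε = 1 := by field_simp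
  rw [e2, e1, one_smul]

/-- The linearisation of the flow at `0` is the linear propagator. -/
lemma IsC2Flow.linearisation [CompleteSpace X] (hF : IsC2Flow α hT ι V Φ) (u₀ : E) {t : ℝ}
    (ht : t ∈ Icc (-T) T) : ∀ᵐ p ∂dualMeasure, curveValue hT (ι (fderiv ℝ Φ 0 u₀)) t p =
      Complex.exp (Complex.I * (t * dispersion α p.1 p.2 : ℝ)) * (u₀ : Sobolev s₁ s₂) p := by
  refine ae_eq_propagator fun k ψ h => ?_
  have := hF.linear_eq u₀ ⟨t, ht⟩ k h
  rwa [← curveValue_of_mem hT] at this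

/-- The second Picard iterate is bounded, because the flow map is twice differentiable. -/
lemma IsC2Flow.exists_duhamel_bound [CompleteSpace X] (hF : IsC2Flow α hT ι V Φ)
    (t : Icc (-T) T) : ∃ C, 0 ≤ C ∧ ∀ (u₀ : E) (k : ℤ) (ψ : ℝ → ℂ) (q : ℂ), IsTest ψ →
      Tendsto (duhamelApprox α (curve hT (ι (fderiv ℝ Φ 0 u₀))) t k ψ) atTop (𝓝 q) →
      ‖q‖ ≤ C * ‖u₀‖ ^ 2 * (dualNorm s₁ s₂ k ψ).toReal := by
  have hcd : ContDiffAt ℝ 2 (fun u₀ => ι (Φ u₀) t) 0 :=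
    (hF.contDiffOn t).contDiffAt (hF.isOpen.mem_nhds hF.zero_mem)
  obtain ⟨C, hC, htaylor⟩ := exists_taylor_bound hcd
  refine ⟨2 * C, by positivity, fun u₀ k ψ q h hq => ?_⟩
  have hfd : ∀ x, fderiv ℝ (fun u₀ => ι (Φ u₀) t) 0 x = ι (fderiv ℝ Φ 0 x) t := fun x => by
    have := ((ContinuousMap.evalCLM ℝ t).comp ι).hasFDerivAt.comp (0 : E)
      hF.differentiableAt_zero.hasFDerivAt
    have h' : HasFDerivAt (fun u₀ => ι (Φ u₀) t)
      (((ContinuousMap.evalCLM ℝ t).comp ι).comp (fderiv ℝ Φ 0)) 0 := this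
    rw [h'.fderiv]
    rfl
  choose Q hQ using fun v : X => hF.hasDuhamel v t t.2 k ψ h
  have hQ' : ∀ v, Tendsto (fun n => pullbackForm ι α hT t k h n v v) atTop (𝓝 (Q v)) := fun v =>
    (hQ v).congr fun n => duhamelApprox_eq_pullbackForm t k h n v
  have hlim := (tendsto_quadratic_curve _ hQ' (hF.hasDerivAt_line u₀)
    (by rw [zero_smul, hF.map_zero])).norm
  -- Now `q` is the limit of `ε⁻² Q (Φ (ε • u₀))`, so a bound for small `ε` suffices. How small `ε`
  -- must be may depend on `u₀`, while the constant does not.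
  rw [tendsto_nhds_unique hq (hQ _)]
  refine le_of_tendsto hlim ?_
  have hline : Tendsto (fun ε : ℝ => ε • u₀) (𝓝[≠] 0) (𝓝 0) := by
    have : Continuous fun ε : ℝ => ε • u₀ := by fun_prop
    simpa using (this.tendsto 0).mono_left nhdsWithin_le_nhds
  filter_upwards [hF.eventually_mem u₀, self_mem_nhdsWithin, hline.eventually htaylor]
    with ε hV hε0 hε
  have hε0' : ε ≠ 0 := hε0
  have h4 := hF.duhamel_eq hV t k h (hQ _)
  -- The datum term equals the pairing with the linear part of the flow, so the Duhamel term becomes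
  -- the pairing with the second order Taylor remainder of `Γₜ`.
  rw [← hF.linear_eq (ε • u₀) t k h, ← map_sub, ← Submodule.coe_sub] at h4
  rw [hfd, hF.map_zero, _root_.map_zero, ContinuousMap.zero_apply, sub_zero] at hε
  have h5 := norm_twistPairing_le (s₁ := s₁) (s₂ := s₂) α t k h
    (ι (Φ (ε • u₀)) t - ι (fderiv ℝ Φ 0 (ε • u₀)) t : E)
  rw [← h4, norm_mul] at h5
  have h6 : ‖Q (Φ (ε • u₀))‖ ≤ 2 * ((dualNorm s₁ s₂ k ψ).toReal * (C * ‖ε • u₀‖ ^ 2)) := by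
    have := h5.trans (mul_le_mul_of_nonneg_left hε ENNReal.toReal_nonneg)
    rw [show ‖(1 / 2 : ℂ)‖ = 1 / 2 by norm_num] at this
    linarith
  rw [norm_smul, norm_pow, norm_inv, Real.norm_eq_abs]
  calc _ ≤ |ε|⁻¹ ^ 2 * (2 * ((dualNorm s₁ s₂ k ψ).toReal * (C * ‖ε • u₀‖ ^ 2))) := by gcongr
    _ = _ := by
      rw [norm_smul, Real.norm_eq_abs]
      have : |ε| ≠ 0 := abs_ne_zero.2 hε0'
      field_simp

end Linearisation

end

/-! ### The resonance function and the choice of frequencies. -/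

lemma abs_rpow_sub_rpow_le {a x y D : ℝ} (hx : 0 < x) (hxy : x ≤ y)
    (hD : ∀ z ∈ Icc x y, |a * z ^ (a - 1)| ≤ D) : |y ^ a - x ^ a| ≤ D * (y - x) := by
  have h := (convex_Icc x y).norm_image_sub_le_of_norm_hasDerivWithin_le
    (f := fun z : ℝ => z ^ a) (f' := fun z => a * z ^ (a - 1)) (C := D)
    (fun z hz => (Real.hasDerivAt_rpow_const (Or.inl (by linarith [hz.1]))).hasDerivWithinAt)
    (fun z hz => hD z hz) (left_mem_Icc.2 hxy) (right_mem_Icc.2 hxy)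
  simpa [Real.norm_eq_abs, abs_of_nonneg (sub_nonneg.2 hxy)] using h

lemma dispersion_of_pos (α : ℝ) {x : ℝ} (hx : 0 < x) (k : ℤ) :
    dispersion α x k = x ^ (α + 1) + (k : ℝ) ^ 2 / x := by
  rw [dispersion, abs_of_pos hx, Real.rpow_add_one hx.ne', mul_comm]

/-- The resonance function of a low frequency `(x, 0)` and a high frequency `(y, k)`. -/
def resonance (α x y : ℝ) (k : ℤ) : ℝ :=
  dispersion α (x + y) k - dispersion α x 0 - dispersion α y k

/-- For `α ≤ 0` the derivative `(α + 1) z ^ α` is bounded on `z ≥ 1`, so a shift of length at most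
`4` changes the dispersion of the high frequency by a bounded amount. -/
lemma abs_resonance_le_of_nonpos {α x y : ℝ} (hα : α ≤ 0) (hx : x ∈ Icc (1 : ℝ) 4)
    (hy : 1 ≤ y) : |resonance α x y 0| ≤ 4 * |α + 1| + 4 ^ |α + 1| := by
  have hx0 : 0 < x := by linarith [hx.1]
  rw [resonance, dispersion_of_pos α (by linarith : 0 < x + y), dispersion_of_pos α hx0,
    dispersion_of_pos α (by linarith : 0 < y)]
  have h1 : |(x + y) ^ (α + 1) - y ^ (α + 1)| ≤ |α + 1| * ((x + y) - y) := by
    refine abs_rpow_sub_rpow_le (by linarith) (by linarith) fun z hz => ?_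
    have hz1 : 1 ≤ z := hy.trans hz.1
    rw [abs_mul, add_sub_cancel_right, abs_of_nonneg (Real.rpow_nonneg (by linarith) α)]
    exact mul_le_of_le_one_right (abs_nonneg _) (Real.rpow_le_one_of_one_le_of_nonpos hz1 hα)
  have h2 : x ^ (α + 1) ≤ 4 ^ |α + 1| :=
    (Real.rpow_le_rpow_of_exponent_le hx.1 (le_abs_self _)).trans
      (Real.rpow_le_rpow hx0.le hx.2 (abs_nonneg _))
  have h3 : 0 ≤ x ^ (α + 1) := Real.rpow_nonneg hx0.le _
  have h4 : |α + 1| * ((x + y) - y) ≤ 4 * |α + 1| := by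
    nlinarith [abs_nonneg (α + 1), hx.2]
  rw [abs_le] at h1 ⊢
  simp only [Int.cast_zero, ne_eq, OfNat.ofNat_ne_zero, not_false_eq_true, zero_pow, zero_div]
  constructor <;> linarith [h1.1, h1.2]

/-- The condition on `k` makes the derivative `(α + 1) z ^ α - k² / z²` vanish at `z = N`. It is
therefore `O(N ^ (α - 1) * γ)` within distance `5 * γ` of `N`, and integrating over a length `x ≤ 4
* γ` gives `O(N ^ (α - 1) * γ ^ 2)`, which is bounded. The low frequency adds at most `4 ^ (α + 1)`.
-/
lemma abs_resonance_le_of_pos {α N γ x y : ℝ} {k : ℤ} (hα : 0 < α) (hN : 5 ≤ N)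
    (hγ : 0 < γ) (hγ1 : γ ≤ 1) (hk : (k : ℝ) ^ 2 = (α + 1) * N ^ (α + 2))
    (hNγ : N ^ (α - 1) * γ ^ 2 ≤ 1) (hx : x ∈ Icc γ (4 * γ)) (hy : y ∈ Icc N (N + γ)) :
    |resonance α x y k| ≤ 20 * (α + 1) * (α + 2) * 2 ^ (α + 1) + 4 ^ (α + 1) := by
  have hN0 : 0 < N := by linarith
  have hx0 : 0 < x := hγ.trans_le hx.1
  have hy0 : 0 < y := hN0.trans_le hy.1
  rw [resonance, dispersion_of_pos α (by linarith : 0 < x + y), dispersion_of_pos α hx0,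
    dispersion_of_pos α hy0]
  have hderiv : ∀ z ∈ Icc y (x + y), |(α + 1) * z ^ α - (k : ℝ) ^ 2 / z ^ 2| ≤
      (α + 1) * (α + 2) * 2 ^ (α + 1) * N ^ (α - 1) * (5 * γ) := by
    intro z hz
    have hzN : N ≤ z := hy.1.trans hz.1
    have hzγ : z ≤ N + 5 * γ := by linarith [hz.2, hx.2, hy.2]
    have hz2 : z ≤ 2 * N := by linarith
    have hz0 : 0 < z := by linarith
    have h1 : |z ^ (α + 2) - N ^ (α + 2)| ≤ ((α + 2) * (2 ^ (α + 1) * N ^ (α + 1))) * (z - N) := by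
      refine abs_rpow_sub_rpow_le hN0 hzN fun w hw => ?_
      have hw0 : 0 < w := by linarith [hw.1]
      rw [abs_of_nonneg (by positivity), ← Real.mul_rpow (by norm_num) hN0.le,
        show α + 2 - 1 = α + 1 by ring]
      gcongr
      exact hw.2.trans hz2
    have h2 : (α + 1) * z ^ α - (k : ℝ) ^ 2 / z ^ 2 =
        (α + 1) * (z ^ (α + 2) - N ^ (α + 2)) / z ^ 2 := by
      rw [hk, show α + 2 = α + (2 : ℕ) by norm_num, Real.rpow_add_natCast hz0.ne']
      field_simp
    have h3 : N ^ (α + 1) = N ^ (α - 1) * N ^ 2 := by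
      rw [← Real.rpow_add_natCast hN0.ne']
      congr 1
      push_cast
      ring
    rw [h2, abs_div, abs_mul, abs_of_pos (by linarith : 0 < α + 1), abs_of_pos (pow_pos hz0 2),
      div_le_iff₀ (pow_pos hz0 2)]
    calc (α + 1) * |z ^ (α + 2) - N ^ (α + 2)|
        ≤ (α + 1) * (((α + 2) * (2 ^ (α + 1) * (N ^ (α - 1) * N ^ 2))) * (5 * γ)) := by
          rw [h3] at h1
          gcongr
          refine h1.trans ?_
          gcongr
          linarith
      _ = (α + 1) * (α + 2) * 2 ^ (α + 1) * N ^ (α - 1) * (5 * γ) * N ^ 2 := by ring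
      _ ≤ _ := by gcongr
  have h1 := (convex_Icc y (x + y)).norm_image_sub_le_of_norm_hasDerivWithin_le
    (f := fun z : ℝ => z ^ (α + 1) + (k : ℝ) ^ 2 / z)
    (f' := fun z => (α + 1) * z ^ α - (k : ℝ) ^ 2 / z ^ 2)
    (fun z hz => by
      have hz0 : z ≠ 0 := by linarith [hz.1]
      have ha := Real.hasDerivAt_rpow_const (x := z) (p := α + 1) (Or.inl hz0)
      have hb := (hasDerivAt_inv hz0).const_mul ((k : ℝ) ^ 2)
      rw [add_sub_cancel_right] at ha
      have hc := (ha.add hb).hasDerivWithinAt (s := Icc y (x + y))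
      rw [mul_neg, ← div_eq_mul_inv, ← sub_eq_add_neg] at hc
      exact hc)
    (fun z hz => by simpa [Real.norm_eq_abs] using hderiv z hz)
    (left_mem_Icc.2 (by linarith)) (right_mem_Icc.2 (by linarith))
  have h2 : (α + 1) * (α + 2) * 2 ^ (α + 1) * N ^ (α - 1) * (5 * γ) * ‖x + y - y‖ ≤
      20 * (α + 1) * (α + 2) * 2 ^ (α + 1) := by
    rw [add_sub_cancel_right, Real.norm_eq_abs, abs_of_pos hx0]
    calc _ ≤ (α + 1) * (α + 2) * 2 ^ (α + 1) * N ^ (α - 1) * (5 * γ) * (4 * γ) := by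
          gcongr
          exact hx.2
      _ = 20 * (α + 1) * (α + 2) * 2 ^ (α + 1) * (N ^ (α - 1) * γ ^ 2) := by ring
      _ ≤ _ := mul_le_of_le_one_right (by positivity) hNγ
  have h3 : x ^ (α + 1) ≤ 4 ^ (α + 1) :=
    Real.rpow_le_rpow hx0.le (by linarith [hx.2]) (by linarith)
  have h4 : 0 ≤ x ^ (α + 1) := Real.rpow_nonneg hx0.le _
  have h5 := h1.trans h2
  rw [Real.norm_eq_abs, abs_le] at h5
  rw [abs_le]
  simp only [Int.cast_zero, ne_eq, OfNat.ofNat_ne_zero, not_false_eq_true, zero_pow, zero_div]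
  constructor <;> linarith [h5.1, h5.2]

/-- Almost resonant low-high interactions with a derivative loss that is not compensated by the
measure of the frequency sets. -/
lemma exists_resonant_frequencies {α : ℝ} (hα : α < 5) :
    ∃ C > 0, ∀ R : ℝ, ∃ (N γ : ℝ) (K : ℤ), 10 ≤ N ∧ 0 < γ ∧ γ ≤ 1 ∧ R ≤ N ^ 2 * γ ∧
      ∀ x ∈ Icc γ (4 * γ), ∀ y ∈ Icc N (N + γ), |resonance α x y K| ≤ C := by
  rcases le_or_gt α 0 with h0 | h0
  · refine ⟨4 * |α + 1| + 4 ^ |α + 1|, by positivity, fun R => ?_⟩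
    -- No transverse frequency is needed: with `γ = 1` and `K = 0` the resonance is bounded for
    -- every `N`.
    refine ⟨max 10 R, 1, 0, le_max_left _ _, one_pos, le_rfl, ?_, fun x hx y hy =>
      abs_resonance_le_of_nonpos h0 (by simpa using hx) ?_⟩
    · nlinarith [le_max_left 10 R, le_max_right 10 R]
    · linarith [le_max_left 10 R, hy.1]
  · refine ⟨20 * (α + 1) * (α + 2) * 2 ^ (α + 1) + 4 ^ (α + 1), by positivity, fun R => ?_⟩
    -- The transverse frequency must be an integer, so `K` is chosen first and the real number `N`
    -- solves `K² = (α + 1) N^{α + 2}`.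
    set n : ℕ → ℝ := fun K => ((K : ℝ) ^ 2 / (α + 1)) ^ (1 / (α + 2)) with hn
    have hlim : Tendsto n atTop atTop := by
      refine (tendsto_rpow_atTop (by positivity)).comp ?_
      exact ((tendsto_pow_atTop two_ne_zero).comp tendsto_natCast_atTop_atTop).atTop_div_const
        (by linarith)
    have hlim2 : Tendsto (fun K => n K ^ ((5 - α) / 4)) atTop atTop :=
      (tendsto_rpow_atTop (by linarith)).comp hlim
    obtain ⟨K, hK1, hK2⟩ :=
      ((hlim.eventually_ge_atTop 10).and (hlim2.eventually_ge_atTop R)).exists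
    have hN0 : 0 < n K := by linarith
    have hN1 : 1 ≤ n K := by linarith
    -- For `γ = N^{-θ}`, bounded resonance needs `θ ≥ (α - 1) / 2` and derivative loss needs `θ <
    -- 2`. The midpoint `θ = (α + 3) / 4` satisfies both as `α < 5`, is positive, and gives `N² γ =
    -- N^{(5 - α) / 4}`.
    refine ⟨n K, n K ^ (-((α + 3) / 4)), K, hK1, Real.rpow_pos_of_pos hN0 _,
      Real.rpow_le_one_of_one_le_of_nonpos hN1 (by linarith), ?_, fun x hx y hy =>
      abs_resonance_le_of_pos h0 (by linarith) (Real.rpow_pos_of_pos hN0 _)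
        (Real.rpow_le_one_of_one_le_of_nonpos hN1 (by linarith)) ?_ ?_ hx hy⟩
    · refine hK2.trans_eq ?_
      rw [← Real.rpow_natCast, ← Real.rpow_add hN0]
      congr 1
      push_cast
      ring
    · rw [hn]
      simp only
      rw [← Real.rpow_mul (by positivity), one_div_mul_cancel (by linarith), Real.rpow_one]
      push_cast
      field_simp
    · rw [← Real.rpow_natCast, ← Real.rpow_mul hN0.le, ← Real.rpow_add hN0]
      refine Real.rpow_le_one_of_one_le_of_nonpos hN1 ?_
      push_cast
      linarith

/-! ### Comparison of weights and construction of the initial data. -/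

lemma rpow_le_rpow_abs_mul {a b r s : ℝ} (ha : 0 < a) (hb : 0 < b) (hr : 1 ≤ r) (hab : a ≤ r * b)
    (hba : b ≤ r * a) : a ^ s ≤ r ^ |s| * b ^ s := by
  have hr0 : 0 < r := by linarith
  rcases le_or_gt 0 s with h | h
  · rw [abs_of_nonneg h, ← Real.mul_rpow hr0.le hb.le]
    exact Real.rpow_le_rpow ha.le hab h
  · rw [abs_of_neg h, Real.rpow_neg hr0.le, mul_comm, ← div_eq_mul_inv,
      le_div_iff₀ (Real.rpow_pos_of_pos hr0 _), ← Real.mul_rpow ha.le hr0.le]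
    exact Real.rpow_le_rpow_of_nonpos hb (by linarith) h.le

lemma weight_le_weight {N x : ℝ} (s₁ s₂ : ℝ) (k : ℤ) (hN : 0 ≤ N) (h1 : N ≤ x) (h2 : x ≤ 2 * N) :
    weight s₁ s₂ (x, k) ≤ 4 ^ |s₁| * weight s₁ s₂ (N, k) ∧
      weight s₁ s₂ (N, k) ≤ 4 ^ |s₁| * weight s₁ s₂ (x, k) := by
  have h3 : N ^ 2 ≤ x ^ 2 := by gcongr
  have h4 : x ^ 2 ≤ 4 * N ^ 2 := by nlinarith
  unfold weight
  simp only [← mul_assoc]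
  constructor
  · gcongr
    exact rpow_le_rpow_abs_mul (by positivity) (by positivity) (by norm_num) (by linarith)
      (by linarith [sq_nonneg N])
  · gcongr
    exact rpow_le_rpow_abs_mul (by positivity) (by positivity) (by norm_num)
      (by linarith [sq_nonneg N]) (by linarith)

lemma weight_neg (s₁ s₂ : ℝ) (p : ℝ × ℤ) : weight s₁ s₂ (-p) = weight s₁ s₂ p := by
  simp [weight]

lemma weight_low_le {x : ℝ} (s₁ s₂ : ℝ) (hx : x ^ 2 ≤ 16) :
    weight s₁ s₂ (x, 0) ≤ 17 ^ |s₁| := by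
  have := rpow_le_rpow_abs_mul (s := s₁) (by positivity : 0 < 1 + x ^ 2) one_pos
    (by norm_num : (1 : ℝ) ≤ 17) (by linarith) (by nlinarith [sq_nonneg x])
  simpa [weight] using this

lemma dualMeasure_Icc_prod (a b : ℝ) (k : ℤ) :
    dualMeasure (Icc a b ×ˢ {k}) = ENNReal.ofReal (b - a) := by
  rw [dualMeasure, Measure.prod_prod, Real.volume_Icc, Measure.count_singleton, mul_one]

/-- The low frequency set. -/
def lowSet (γ : ℝ) : Set (ℝ × ℤ) := Icc γ (4 * γ) ×ˢ {0}

/-- The high frequency set. -/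
def highSet (N γ : ℝ) (K : ℤ) : Set (ℝ × ℤ) := Icc N (N + γ) ×ˢ {K}

/-- The positive frequency part of the initial values. -/
def halfData (N γ b : ℝ) (K : ℤ) (p : ℝ × ℤ) : ℝ :=
  (lowSet γ).indicator (fun _ => 1) p + (highSet N γ K).indicator (fun _ => b) p

/-- The Fourier transform of the initial values which exhibit the derivative loss. -/
def data (N γ b : ℝ) (K : ℤ) (p : ℝ × ℤ) : ℝ := halfData N γ b K p + halfData N γ b K (-p)

section Data

variable {N γ b : ℝ} {K : ℤ}

lemma measurableSet_Icc_prod (a b : ℝ) (k : ℤ) : MeasurableSet (Icc a b ×ˢ ({k} : Set ℤ)) :=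
  measurableSet_Icc.prod (measurableSet_singleton k)

lemma measurable_halfData : Measurable (halfData N γ b K) :=
  (measurable_const.indicator (measurableSet_Icc_prod _ _ _)).add
    (measurable_const.indicator (measurableSet_Icc_prod _ _ _))

lemma measurable_data : Measurable (data N γ b K) :=
  measurable_halfData.add (measurable_halfData.comp measurable_neg)

lemma data_neg (p : ℝ × ℤ) : data N γ b K (-p) = data N γ b K p := by
  rw [data, data, neg_neg, add_comm]

lemma halfData_nonneg (hb : 0 ≤ b) (p : ℝ × ℤ) : 0 ≤ halfData N γ b K p :=
  add_nonneg (indicator_nonneg (fun _ _ => zero_le_one) _) (indicator_nonneg (fun _ _ => hb) _)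

lemma data_nonneg (hb : 0 ≤ b) (p : ℝ × ℤ) : 0 ≤ data N γ b K p :=
  add_nonneg (halfData_nonneg hb _) (halfData_nonneg hb _)

lemma mem_of_halfData_ne_zero {p : ℝ × ℤ} (h : halfData N γ b K p ≠ 0) :
    p ∈ lowSet γ ∪ highSet N γ K := by
  contrapose! h
  rw [mem_union, not_or] at h
  rw [halfData, indicator_of_notMem h.1, indicator_of_notMem h.2, add_zero]

lemma mem_of_data_ne_zero {p : ℝ × ℤ} (h : data N γ b K p ≠ 0) :
    p ∈ lowSet γ ∪ highSet N γ K ∨ -p ∈ lowSet γ ∪ highSet N γ K := by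
  contrapose! h
  rw [data, not_imp_comm.1 mem_of_halfData_ne_zero h.1, not_imp_comm.1 mem_of_halfData_ne_zero h.2,
    add_zero]

lemma integrable_halfData : Integrable (halfData N γ b K) dualMeasure := by
  refine Integrable.add ?_ ?_
  · exact (integrableOn_const (by rw [lowSet, dualMeasure_Icc_prod]; exact ENNReal.ofReal_ne_top)
      ).integrable_indicator (measurableSet_Icc_prod _ _ _)
  · exact (integrableOn_const (by rw [highSet, dualMeasure_Icc_prod]; exact ENNReal.ofReal_ne_top)
      ).integrable_indicator (measurableSet_Icc_prod _ _ _)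

lemma measurePreserving_neg : MeasurePreserving (fun p : ℝ × ℤ => -p) dualMeasure dualMeasure := by
  simpa using measurePreserving_const_sub 0

lemma integrable_data : Integrable (data N γ b K) dualMeasure :=
  integrable_halfData.add (measurePreserving_neg.integrable_comp_of_integrable integrable_halfData)

lemma halfData_le (hb : 0 ≤ b) (p : ℝ × ℤ) : halfData N γ b K p ≤ 1 + b :=
  add_le_add (indicator_le_self' (fun _ _ => zero_le_one) p)
    (indicator_le_self' (fun _ _ => hb) p)

lemma data_le (hb : 0 ≤ b) (p : ℝ × ℤ) : data N γ b K p ≤ 2 * (1 + b) := by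
  rw [data, two_mul]
  exact add_le_add (halfData_le hb p) (halfData_le hb _)

lemma le_data_of_mem_high (hb : 0 ≤ b) {p : ℝ × ℤ} (hp : p ∈ highSet N γ K) :
    b ≤ data N γ b K p := by
  rw [data, halfData, indicator_of_mem hp]
  have h1 := indicator_nonneg (s := lowSet γ) (f := fun _ => (1 : ℝ)) (fun _ _ => zero_le_one) p
  have h2 := halfData_nonneg (N := N) (γ := γ) (K := K) hb (-p)
  linarith

lemma one_le_data_of_mem_low (hb : 0 ≤ b) {p : ℝ × ℤ} (hp : p ∈ lowSet γ) :
    1 ≤ data N γ b K p := by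
  rw [data, halfData, indicator_of_mem hp]
  have h1 := indicator_nonneg (s := highSet N γ K) (f := fun _ => b) (fun _ _ => hb) p
  have h2 := halfData_nonneg (N := N) (γ := γ) (K := K) hb (-p)
  linarith

variable (hN : 10 ≤ N) (hγ : 0 < γ) (hγ1 : γ ≤ 1)

include hN hγ hγ1

/-- The normalisation of `b` makes the weighted high part of size one, so the squared norm of the
data is governed by the measure of the supports, which is `O(γ)`. -/
lemma weight_mul_halfData_sq_le (s₁ s₂ : ℝ) (hb : b ^ 2 * weight s₁ s₂ (N, K) = 1) (p : ℝ × ℤ) :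
    weight s₁ s₂ p * halfData N γ b K p ^ 2 ≤
      (lowSet γ ∪ highSet N γ K).indicator (fun _ => (17 : ℝ) ^ |s₁|) p := by
  by_cases hp : p ∈ lowSet γ ∪ highSet N γ K
  · rw [indicator_of_mem hp]
    obtain ⟨x, k⟩ := p
    rcases hp with hp | hp
    · have hx : x ∈ Icc γ (4 * γ) := hp.1
      have hk : k = 0 := hp.2
      have hp2 : ((x, k) : ℝ × ℤ) ∉ highSet N γ K := fun h => by
        have : x ∈ Icc N (N + γ) := h.1
        linarith [this.1, hx.2]
      rw [halfData, indicator_of_mem hp, indicator_of_notMem hp2, add_zero, one_pow, mul_one, hk]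
      refine weight_low_le s₁ s₂ ?_
      nlinarith [hx.1, hx.2]
    · have hx : x ∈ Icc N (N + γ) := hp.1
      have hk : k = K := hp.2
      have hp2 : ((x, k) : ℝ × ℤ) ∉ lowSet γ := fun h => by
        have : x ∈ Icc γ (4 * γ) := h.1
        linarith [this.2, hx.1]
      rw [halfData, indicator_of_mem hp, indicator_of_notMem hp2, zero_add, hk]
      have h1 := (weight_le_weight s₁ s₂ K (by linarith) hx.1 (by linarith [hx.2])).1
      calc _ ≤ 4 ^ |s₁| * weight s₁ s₂ (N, K) * b ^ 2 := by gcongr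
        _ = 4 ^ |s₁| * (b ^ 2 * weight s₁ s₂ (N, K)) := by ring
        _ = 4 ^ |s₁| := by rw [hb, mul_one]
        _ ≤ _ := by gcongr; norm_num
  · rw [indicator_of_notMem hp, not_imp_comm.1 mem_of_halfData_ne_zero hp]
    simp

omit hγ1 in
-- One factor lives on `ξ > 0` and the other on `ξ < 0`, so the squares of the two halves add
-- without a cross term.
lemma halfData_mul_halfData_neg (p : ℝ × ℤ) :
    halfData N γ b K p * halfData N γ b K (-p) = 0 := by
  by_contra h
  have h1 : 0 < p.1 := by
    rcases mem_of_halfData_ne_zero (left_ne_zero_of_mul h) with h | h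
    · exact hγ.trans_le h.1.1
    · exact lt_of_lt_of_le (by linarith) h.1.1
  have h2 : 0 < (-p).1 := by
    rcases mem_of_halfData_ne_zero (right_ne_zero_of_mul h) with h | h
    · exact hγ.trans_le h.1.1
    · exact lt_of_lt_of_le (by linarith) h.1.1
  rw [Prod.fst_neg] at h2
  linarith

lemma lintegral_halfData_le (s₁ s₂ : ℝ) (hb : b ^ 2 * weight s₁ s₂ (N, K) = 1) :
    ∫⁻ p, ENNReal.ofReal (weight s₁ s₂ p * halfData N γ b K p ^ 2) ∂dualMeasure ≤
      ENNReal.ofReal (17 ^ |s₁| * (4 * γ)) := by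
  calc _ ≤ ∫⁻ p, (lowSet γ ∪ highSet N γ K).indicator
        (fun _ => ENNReal.ofReal ((17 : ℝ) ^ |s₁|)) p ∂dualMeasure := by
        refine lintegral_mono fun p => ?_
        refine (ENNReal.ofReal_le_ofReal
          (weight_mul_halfData_sq_le hN hγ hγ1 s₁ s₂ hb p)).trans_eq ?_
        by_cases hp : p ∈ lowSet γ ∪ highSet N γ K
        · rw [indicator_of_mem hp, indicator_of_mem hp]
        · rw [indicator_of_notMem hp, indicator_of_notMem hp, ENNReal.ofReal_zero]
    _ = ENNReal.ofReal ((17 : ℝ) ^ |s₁|) * dualMeasure (lowSet γ ∪ highSet N γ K) :=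
        lintegral_indicator_const
          ((measurableSet_Icc_prod _ _ _).union (measurableSet_Icc_prod _ _ _)) _
    _ ≤ ENNReal.ofReal ((17 : ℝ) ^ |s₁|) * ENNReal.ofReal (4 * γ) := by
        gcongr
        refine (measure_union_le _ _).trans_eq ?_
        -- The intervals have lengths `3 * γ` and `γ`.
        rw [lowSet, highSet, dualMeasure_Icc_prod, dualMeasure_Icc_prod,
          ← ENNReal.ofReal_add (by linarith) (by linarith)]
        congr 1
        ring
    _ = _ := (ENNReal.ofReal_mul (by positivity)).symm

lemma lintegral_data_le (s₁ s₂ : ℝ) (hb : b ^ 2 * weight s₁ s₂ (N, K) = 1) :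
    ∫⁻ p, ENNReal.ofReal (weight s₁ s₂ p * data N γ b K p ^ 2) ∂dualMeasure ≤
      ENNReal.ofReal (17 ^ |s₁| * (8 * γ)) := by
  have hm : Measurable fun p => ENNReal.ofReal (weight s₁ s₂ p * halfData N γ b K p ^ 2) :=
    ((measurable_weight s₁ s₂).mul (measurable_halfData.pow_const 2)).ennreal_ofReal
  have h1 : ∀ p, ENNReal.ofReal (weight s₁ s₂ p * data N γ b K p ^ 2) =
      ENNReal.ofReal (weight s₁ s₂ p * halfData N γ b K p ^ 2) +
        ENNReal.ofReal (weight s₁ s₂ (-p) * halfData N γ b K (-p) ^ 2) := fun p => by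
    have hw := weight_pos s₁ s₂ p
    rw [weight_neg, ← ENNReal.ofReal_add (by positivity) (by positivity), data]
    congr 1
    linear_combination 2 * weight s₁ s₂ p * halfData_mul_halfData_neg hN hγ (b := b) (K := K) p
  simp_rw [h1]
  rw [lintegral_add_left hm, measurePreserving_neg.lintegral_comp hm]
  have h2 := lintegral_halfData_le hN hγ hγ1 s₁ s₂ hb
  refine (add_le_add h2 h2).trans_eq ?_
  rw [← ENNReal.ofReal_add (by positivity) (by positivity)]
  congr 1
  ring

/-- The initial values as an element of the Sobolev space. -/
lemma exists_sobolev_data (s₁ s₂ : ℝ) (hb : b ^ 2 * weight s₁ s₂ (N, K) = 1) :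
    ∃ h : Sobolev s₁ s₂, h ∈ realValued s₁ s₂ ∧ (∀ᵐ p ∂dualMeasure, h p = data N γ b K p) ∧
      ‖h‖ ^ 2 ≤ 17 ^ |s₁| * (8 * γ) := by
  have hm : Measurable fun p => (data N γ b K p : ℂ) :=
    Complex.measurable_ofReal.comp measurable_data
  have hint : ∫⁻ p, ‖(data N γ b K p : ℂ)‖ₑ ^ (2 : ℝ) ∂(sobolevMeasure s₁ s₂) ≤
      ENNReal.ofReal (17 ^ |s₁| * (8 * γ)) := by
    rw [lintegral_sobolevMeasure s₁ s₂ _ (hm.enorm.pow_const 2)]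
    refine le_of_eq_of_le (lintegral_congr fun p => ?_) (lintegral_data_le hN hγ hγ1 s₁ s₂ hb)
    rw [← ofReal_norm, ENNReal.ofReal_rpow_of_nonneg (norm_nonneg _) (by norm_num),
      ← ENNReal.ofReal_mul (weight_pos s₁ s₂ p).le, Complex.norm_real, Real.norm_eq_abs,
      Real.rpow_two, sq_abs]
  have hL : MemLp (fun p => (data N γ b K p : ℂ)) 2 (sobolevMeasure s₁ s₂) := by
    refine ⟨hm.aestronglyMeasurable, ?_⟩
    rw [eLpNorm_lt_top_iff_lintegral_rpow_enorm_lt_top (by norm_num) (by norm_num)]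
    exact lt_of_le_of_lt hint ENNReal.ofReal_lt_top
  have hae := hL.coeFn_toLp
  refine ⟨hL.toLp, ?_, ae_sobolevMeasure_iff.1 hae, ?_⟩
  · change ∀ᵐ p ∂(sobolevMeasure s₁ s₂), hL.toLp _ (-p) = (starRingEnd ℂ) (hL.toLp _ p)
    filter_upwards [hae, ae_neg_of_ae s₁ s₂ hae] with p h1 h2
    rw [h1, h2, data_neg, Complex.conj_ofReal]
  · rw [← ENNReal.ofReal_le_ofReal_iff (by positivity), ← Real.rpow_two,
      ← ENNReal.ofReal_rpow_of_nonneg (norm_nonneg _) (by norm_num), ← lintegral_enorm_sq,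
      ← lintegral_sobolevMeasure s₁ s₂ _ ((Sobolev.measurable _).enorm.pow_const 2)]
    refine le_of_eq_of_le (lintegral_congr_ae ?_) hint
    filter_upwards [hae] with p h1
    rw [h1]

/-- Only the interaction of low and high positive frequencies reaches the output frequencies. -/
lemma low_high_of_data_mul_ne_zero {ξ : ℝ} (hξ : ξ ∈ Icc (N + 2 * γ) (N + 4 * γ)) {q : ℝ × ℤ}
    (h : data N γ b K q * data N γ b K ((ξ, K) - q) ≠ 0) :
    (q ∈ lowSet γ ∧ (ξ, K) - q ∈ highSet N γ K) ∨
      (q ∈ highSet N γ K ∧ (ξ, K) - q ∈ lowSet γ) := by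
  have h1 := mem_of_data_ne_zero (left_ne_zero_of_mul h)
  have h2 := mem_of_data_ne_zero (right_ne_zero_of_mul h)
  simp only [lowSet, highSet, mem_union, mem_prod, mem_Icc, mem_singleton_iff, Prod.fst_sub,
    Prod.snd_sub, Prod.fst_neg, Prod.snd_neg] at h1 h2 ⊢
  obtain ⟨hξ1, hξ2⟩ := hξ
  -- The first coordinate rules out all other cases: low plus low is at most `8 * γ < N`, high plus
  -- high is at least `2 * N > N + 4 * γ`, and any negative summand leaves at most `N`.
  rcases h1 with (h1 | h1) | (h1 | h1) <;> rcases h2 with (h2 | h2) | (h2 | h2)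
  all_goals first
    | exact Or.inl ⟨h1, h2⟩
    | exact Or.inr ⟨h1, h2⟩
    | (exfalso; linarith [h1.1.1, h1.1.2, h2.1.1, h2.1.2])

lemma abs_phase_le {α C ξ : ℝ} (hξ : ξ ∈ Icc (N + 2 * γ) (N + 4 * γ)) {q : ℝ × ℤ}
    (hC : ∀ x ∈ Icc γ (4 * γ), ∀ y ∈ Icc N (N + γ), |resonance α x y K| ≤ C)
    (h : data N γ b K q * data N γ b K ((ξ, K) - q) ≠ 0) :
    |dispersion α ξ K - dispersion α q.1 q.2 - dispersion α (ξ - q.1) (K - q.2)| ≤ C := by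
  obtain ⟨x, k⟩ := q
  rcases low_high_of_data_mul_ne_zero hN hγ hγ1 hξ h with ⟨h1, h2⟩ | ⟨h1, h2⟩
  · have hk : k = 0 := h1.2
    have := hC x h1.1 (ξ - x) h2.1
    rw [resonance, add_sub_cancel] at this
    simpa [hk] using this
  · have hk : k = K := h1.2
    have := hC (ξ - x) h2.1 x h1.1
    rw [resonance, sub_add_cancel] at this
    rw [sub_right_comm]
    simpa [hk] using this

omit hN hγ hγ1 in
-- The lengths of the intervals are chosen for this: every high frequency has a low partner for
-- every output frequency, so the convolution sees the full measure `γ` of the high set.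
lemma high_mem_of_output {ξ : ℝ} (hξ : ξ ∈ Icc (N + 2 * γ) (N + 4 * γ)) {q : ℝ × ℤ}
    (hq : q ∈ highSet N γ K) : (ξ, K) - q ∈ lowSet γ := by
  have h1 : q.1 ∈ Icc N (N + γ) := hq.1
  have h2 : q.2 = K := hq.2
  refine ⟨⟨?_, ?_⟩, ?_⟩
  · simp only [Prod.fst_sub]
    linarith [h1.2, hξ.1]
  · simp only [Prod.fst_sub]
    linarith [h1.1, hξ.2]
  · simp [h2]

end Data

/-! ### Lower bound for the second Picard iterate. -/

/-- The Fourier transform of the linear evolution of the initial values. -/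
def evolvedData (α s N γ b : ℝ) (K : ℤ) (p : ℝ × ℤ) : ℂ :=
  Complex.exp (Complex.I * (s * dispersion α p.1 p.2 : ℝ)) * data N γ b K p

section LowerBound

variable {α s N γ b C : ℝ} {K : ℤ}

lemma norm_exp_I_mul (x : ℝ) : ‖Complex.exp (Complex.I * (x : ℝ))‖ = 1 := by
  rw [mul_comm, Complex.norm_exp_ofReal_mul_I]

lemma measurable_evolvedData : Measurable (evolvedData α s N γ b K) := by
  have hd : Measurable fun p : ℝ × ℤ => dispersion α p.1 p.2 := by
    refine (measurable_fst.mul (measurable_fst.abs.pow_const α)).add (Measurable.div ?_ measurable_fst)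
    exact ((measurable_from_top (f := fun k : ℤ => (k : ℝ))).comp measurable_snd).pow_const 2
  exact (Complex.measurable_exp.comp ((Complex.measurable_ofReal.comp (hd.const_mul s)).const_mul _)
    ).mul (Complex.measurable_ofReal.comp measurable_data)

lemma norm_evolvedData (hb : 0 ≤ b) (p : ℝ × ℤ) :
    ‖evolvedData α s N γ b K p‖ = data N γ b K p := by
  rw [evolvedData, norm_mul, norm_exp_I_mul, one_mul, Complex.norm_real,
    Real.norm_of_nonneg (data_nonneg hb p)]

lemma integrable_evolvedData_mul (hb : 0 ≤ b) (p : ℝ × ℤ) :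
    Integrable (fun q => evolvedData α s N γ b K q * evolvedData α s N γ b K (p - q))
      dualMeasure := by
  have h1 : Integrable (evolvedData α s N γ b K) dualMeasure :=
    integrable_data.mono' measurable_evolvedData.aestronglyMeasurable
      (Eventually.of_forall fun q => (norm_evolvedData hb q).le)
  refine h1.mul_bdd (c := 2 * (1 + b)) ?_ (Eventually.of_forall fun q => ?_)
  · exact (measurable_evolvedData.comp (measurePreserving_const_sub p).measurable
      ).aestronglyMeasurable
  · rw [norm_evolvedData hb]
    exact data_le hb _

lemma half_le_cos {x : ℝ} (hx : |x| ≤ 1) : 1 / 2 ≤ Real.cos x := by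
  have h1 := Real.one_sub_sq_div_two_le_cos (x := x)
  have h2 : x ^ 2 ≤ 1 := (sq_le_one_iff_abs_le_one x).2 hx
  linarith

variable (hN : 10 ≤ N) (hγ : 0 < γ) (hγ1 : γ ≤ 1) (hb : 0 < b)
  (hC : ∀ x ∈ Icc γ (4 * γ), ∀ y ∈ Icc N (N + γ), |resonance α x y K| ≤ C) (hs : |s| * C ≤ 1)

include hN hγ hγ1 hb hC hs

/-- The integrand carries the phase `-s` times the resonance function, of size at most one, so its
cosine is at least `1/2`. The data are nonnegative, so nothing cancels and one may keep only `q` in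
the high set, where the product of the data is at least `b`. -/
lemma re_conv_evolvedData_ge {ξ : ℝ} (hξ : ξ ∈ Icc (N + 2 * γ) (N + 4 * γ)) :
    b * γ / 2 ≤ (Complex.exp (-(Complex.I * (s * dispersion α ξ K : ℝ))) *
      conv (evolvedData α s N γ b K) (evolvedData α s N γ b K) (ξ, K)).re := by
  set e := Complex.exp (-(Complex.I * (s * dispersion α ξ K : ℝ))) with he
  have hint := (integrable_evolvedData_mul (α := α) (s := s) (N := N) (γ := γ) (K := K)
    hb.le (ξ, K)).const_mul e
  have hre := Complex.reCLM.integral_comp_comm hint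
  simp only [Complex.reCLM_apply] at hre
  rw [conv, ← integral_const_mul, ← hre]
  have hind : ∫ q, (highSet N γ K).indicator (fun _ => b / 2) q ∂dualMeasure = b * γ / 2 := by
    have hms : MeasurableSet (highSet N γ K) := measurableSet_Icc_prod _ _ _
    rw [integral_indicator_const _ hms, Measure.real, highSet,
      dualMeasure_Icc_prod, add_sub_cancel_left, ENNReal.toReal_ofReal hγ.le, smul_eq_mul]
    ring
  rw [← hind]
  refine integral_mono ?_ (Complex.reCLM.integrable_comp hint) fun q => ?_
  · exact (integrableOn_const (by rw [highSet, dualMeasure_Icc_prod]; exact ENNReal.ofReal_ne_top)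
      ).integrable_indicator (measurableSet_Icc_prod _ _ _)
  · have hphase : (e * (evolvedData α s N γ b K q * evolvedData α s N γ b K ((ξ, K) - q))).re =
        Real.cos (-(s * (dispersion α ξ K - dispersion α q.1 q.2 -
          dispersion α (ξ - q.1) (K - q.2)))) *
          (data N γ b K q * data N γ b K ((ξ, K) - q)) := by
      rw [← Complex.exp_ofReal_mul_I_re, ← Complex.re_mul_ofReal, he, evolvedData, evolvedData]
      congr 1
      have h3 : ∀ x y z d₁ d₂ : ℂ, Complex.exp x * (Complex.exp y * d₁ * (Complex.exp z * d₂)) =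
          Complex.exp (x + y + z) * (d₁ * d₂) := fun x y z d₁ d₂ => by
        rw [Complex.exp_add, Complex.exp_add]
        ring
      rw [h3, Complex.ofReal_mul (data N γ b K q)]
      congr 2
      simp only [Prod.fst_sub, Prod.snd_sub]
      push_cast
      ring
    simp only [hphase]
    have hnn : 0 ≤ data N γ b K q * data N γ b K ((ξ, K) - q) :=
      mul_nonneg (data_nonneg hb.le _) (data_nonneg hb.le _)
    have hcos : data N γ b K q * data N γ b K ((ξ, K) - q) ≠ 0 → 1 / 2 ≤ Real.cos
        (-(s * (dispersion α ξ K - dispersion α q.1 q.2 -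
          dispersion α (ξ - q.1) (K - q.2)))) := fun h => by
      refine half_le_cos ?_
      rw [abs_neg, abs_mul]
      exact (mul_le_mul_of_nonneg_left (abs_phase_le hN hγ hγ1 hξ hC h) (abs_nonneg s)).trans hs
    by_cases hq : q ∈ highSet N γ K
    · rw [indicator_of_mem hq]
      have h1 := le_data_of_mem_high (γ := γ) hb.le hq
      have h2 := one_le_data_of_mem_low (N := N) (K := K) hb.le (high_mem_of_output hξ hq)
      have h3 : b * 1 ≤ data N γ b K q * data N γ b K ((ξ, K) - q) :=
        mul_le_mul h1 h2 zero_le_one (data_nonneg hb.le _)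
      have h4 := hcos (by linarith [h3] : _ < _).ne'
      calc b / 2 = 1 / 2 * (b * 1) := by ring
        _ ≤ _ := by gcongr
    · rw [indicator_of_notMem hq]
      by_cases h0 : data N γ b K q * data N γ b K ((ξ, K) - q) = 0
      · rw [h0, mul_zero]
      · have := hcos h0
        positivity

omit hb hC hs in
-- The data have bounded support, so for large `n` the truncation is inactive.
lemma truncate_evolvedData {n : ℕ} (hn : N + 1 ≤ n) (hK : |K| ≤ n) :
    truncate n (evolvedData α s N γ b K) = evolvedData α s N γ b K := by
  rw [truncate, indicator_eq_self]
  intro p hp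
  have h : data N γ b K p ≠ 0 := fun h => hp (by rw [evolvedData, h, Complex.ofReal_zero, mul_zero])
  have key : ∀ q ∈ lowSet γ ∪ highSet N γ K, |q.1| ≤ n ∧ |q.2| ≤ n := by
    rintro ⟨x, k⟩ (⟨hx, hk⟩ | ⟨hx, hk⟩)
    · have hx' : x ∈ Icc γ (4 * γ) := hx
      have hk' : k = 0 := hk
      simp only [hk']
      rw [abs_of_nonneg (by linarith [hx'.1])]
      exact ⟨by linarith [hx'.2], by simp⟩
    · have hx' : x ∈ Icc N (N + γ) := hx
      have hk' : k = K := hk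
      simp only [hk']
      rw [abs_of_nonneg (by linarith [hx'.1])]
      exact ⟨by linarith [hx'.2], hK⟩
  rcases mem_of_data_ne_zero h with h | h
  · exact key p h
  · simpa using key (-p) h

/-- The factor `i` of `∂ₓ` turns the real part of the convolution into an imaginary part, and the
factor `ξ ≥ N` is the derivative loss. -/
lemma im_modeForm_ge {s₁ s₂ : ℝ} {n : ℕ} (hn : N + 1 ≤ n) (hK : |K| ≤ n) {f : Sobolev s₁ s₂}
    (hf : ∀ᵐ p ∂dualMeasure, f p = evolvedData α s N γ b K p) {φ : ℝ → ℝ}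
    (hφ : IsTest fun ξ => (φ ξ : ℂ)) (hφ0 : ∀ ξ, 0 ≤ φ ξ)
    (hφs : ∀ ξ ∉ Icc (N + 2 * γ) (N + 4 * γ), φ ξ = 0) :
    N * (b * γ / 2) * ∫ ξ, φ ξ ≤ (modeForm s₁ s₂ n K (duhamelMultiplier α K (fun ξ => (φ ξ : ℂ)) s)
      (hφ.integrable_duhamelMultiplier α K s) f f).im := by
  have hint := integrable_mul_truncConv n K (hφ.integrable_duhamelMultiplier α K s) f f
  have him := Complex.imCLM.integral_comp_comm hint
  simp only [Complex.imCLM_apply] at him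
  have hφi : Integrable φ := by
    have := (hφ.smooth.continuous.integrable_of_hasCompactSupport (μ := volume) hφ.compact).re
    exact this
  change _ ≤ (∫ ξ : ℝ, duhamelMultiplier α K (fun ξ => (φ ξ : ℂ)) s ξ *
    truncConv s₁ s₂ n (ξ, K) f f).im
  rw [← him, ← integral_const_mul]
  refine integral_mono (hφi.const_mul _) (Complex.imCLM.integrable_comp hint) fun ξ => ?_
  have htr : truncate n f =ᵐ[dualMeasure] evolvedData α s N γ b K := by
    have := truncate_congr_ae n hf
    rwa [truncate_evolvedData hN hγ hγ1 hn hK] at this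
  simp only [truncConv_apply, conv_congr_ae htr htr]
  by_cases hξ : ξ ∈ Icc (N + 2 * γ) (N + 4 * γ)
  · have h1 := re_conv_evolvedData_ge hN hγ hγ1 hb hC hs hξ
    have h2 : duhamelMultiplier α K (fun ξ => (φ ξ : ℂ)) s ξ *
        conv (evolvedData α s N γ b K) (evolvedData α s N γ b K) (ξ, K) =
        ((ξ * φ ξ : ℝ) : ℂ) * (Complex.I *
          (Complex.exp (-(Complex.I * (s * dispersion α ξ K : ℝ))) *
            conv (evolvedData α s N γ b K) (evolvedData α s N γ b K) (ξ, K))) := by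
      rw [duhamelMultiplier, Complex.ofReal_mul ξ (φ ξ)]
      ring
    rw [h2, Complex.im_ofReal_mul, Complex.I_mul_im]
    have h3 : N ≤ ξ := by linarith [hξ.1]
    have h4 := hφ0 ξ
    calc N * (b * γ / 2) * φ ξ = N * φ ξ * (b * γ / 2) := by ring
      _ ≤ ξ * φ ξ * (b * γ / 2) := by gcongr
      _ ≤ _ := mul_le_mul_of_nonneg_left h1 (mul_nonneg (by linarith) h4)
  · rw [hφs ξ hξ, duhamelMultiplier, hφs ξ hξ]
    simp

end LowerBound

lemma im_duhamelApprox_ge {s₁ s₂ α T t N γ b C : ℝ} {K : ℤ} {E : Submodule ℝ (Sobolev s₁ s₂)}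
    (hT : 0 < T) (hN : 10 ≤ N) (hγ : 0 < γ) (hγ1 : γ ≤ 1) (hb : 0 < b)
    (hC : ∀ x ∈ Icc γ (4 * γ), ∀ y ∈ Icc N (N + γ), |resonance α x y K| ≤ C) (hC0 : 0 ≤ C)
    (ht : 0 ≤ t) (htC : t * C ≤ 1) {n : ℕ} (hn : N + 1 ≤ n) (hK : |K| ≤ n)
    {u : C(Icc (-T) T, E)}
    (hu : ∀ s ∈ Icc 0 t, ∀ᵐ p ∂dualMeasure, curveValue hT u s p = evolvedData α s N γ b K p)
    {φ : ℝ → ℝ} (hφ : IsTest fun ξ => (φ ξ : ℂ)) (hφ0 : ∀ ξ, 0 ≤ φ ξ)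
    (hφs : ∀ ξ ∉ Icc (N + 2 * γ) (N + 4 * γ), φ ξ = 0) :
    t * (N * (b * γ / 2) * ∫ ξ, φ ξ) ≤
      (duhamelApprox α (curve hT u) t K (fun ξ => (φ ξ : ℂ)) n).im := by
  rw [duhamelApprox_curve α hT t K hφ, duhamelForm_apply]
  have hc := continuous_modeForm_curveValue α hT n K hφ u u
  have him := Complex.imCLM.intervalIntegral_comp_comm (hc.intervalIntegrable (μ := volume) 0 t)
  simp only [Complex.imCLM_apply] at him
  rw [← him]
  have h1 : t * (N * (b * γ / 2) * ∫ ξ, φ ξ) =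
      ∫ _ in (0 : ℝ)..t, N * (b * γ / 2) * ∫ ξ, φ ξ := by
    rw [intervalIntegral.integral_const, sub_zero, smul_eq_mul]
  rw [h1]
  refine intervalIntegral.integral_mono_on ht (intervalIntegrable_const (μ := volume))
    ((Complex.continuous_im.comp hc).intervalIntegrable (μ := volume) 0 t) fun s hs => ?_
  refine im_modeForm_ge hN hγ hγ1 hb hC ?_ hn hK (hu s hs) hφ hφ0 hφs
  rw [abs_of_nonneg hs.1]
  exact (mul_le_mul_of_nonneg_right hs.2 hC0).trans htC

/-! ### The test function and the final contradiction. -/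

/-- There is a bump adapted to the output frequencies. -/
lemma exists_bump {N γ : ℝ} (hN : 0 ≤ N) (hγ : 0 < γ) :
    ∃ φ : ℝ → ℝ, IsTest (fun ξ => (φ ξ : ℂ)) ∧ (∀ ξ, 0 ≤ φ ξ) ∧ (∀ ξ, φ ξ ≤ 1) ∧
      (∀ ξ ∉ Icc (N + 2 * γ) (N + 4 * γ), φ ξ = 0) ∧ γ ≤ ∫ ξ, φ ξ := by
  -- The outer radius `γ` makes the support the output interval; the inner radius `γ / 2` yields a
  -- plateau of length `γ`.
  let φ : ContDiffBump (N + 3 * γ) := ⟨γ / 2, γ, by linarith, by linarith⟩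
  have hball : Metric.closedBall (N + 3 * γ) γ = Icc (N + 2 * γ) (N + 4 * γ) := by
    rw [Real.closedBall_eq_Icc]
    congr 1 <;> ring
  have hts : tsupport φ = Icc (N + 2 * γ) (N + 4 * γ) := φ.tsupport_eq.trans hball
  refine ⟨φ, isTest_ofReal φ.contDiff φ.hasCompactSupport ?_, fun ξ => φ.nonneg, fun ξ => φ.le_one,
    fun ξ hξ => image_eq_zero_of_notMem_tsupport (by rwa [hts]), ?_⟩
  · rw [hts]
    rintro ⟨h, -⟩
    linarith
  · refine le_trans (le_of_eq ?_) (φ.measure_closedBall_le_integral volume)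
    rw [Measure.real, Real.volume_closedBall, ENNReal.toReal_ofReal (by positivity)]
    change γ = 2 * (γ / 2)
    ring

/-- On the output interval, of length `2 * γ`, the weight is comparable to its value `b⁻²` at `(N,
K)`. The resulting factor `b` matches the one in the lower bound and cancels. -/
lemma dualNorm_bump_le {s₁ s₂ N γ b : ℝ} {K : ℤ} (hN : 10 ≤ N) (hγ : 0 < γ) (hγ1 : γ ≤ 1)
    (hb : b ^ 2 * weight s₁ s₂ (N, K) = 1) {φ : ℝ → ℝ} (hφ0 : ∀ ξ, 0 ≤ φ ξ) (hφ1 : ∀ ξ, φ ξ ≤ 1)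
    (hφs : ∀ ξ ∉ Icc (N + 2 * γ) (N + 4 * γ), φ ξ = 0) :
    (dualNorm s₁ s₂ K fun ξ => (φ ξ : ℂ)).toReal ^ 2 ≤ 4 ^ |s₁| * b ^ 2 * (2 * γ) := by
  have h := dualNorm_le (s₁ := s₁) (s₂ := s₂) (k := K) (m := fun ξ => (φ ξ : ℂ))
    (A := Icc (N + 2 * γ) (N + 4 * γ)) (B := 4 ^ |s₁| * b ^ 2) measurableSet_Icc
    (fun ξ hξ => by rw [hφs ξ hξ, Complex.ofReal_zero]) fun ξ hξ => by
      rw [Complex.norm_real, Real.norm_of_nonneg (hφ0 ξ)]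
      have h1 := (weight_le_weight s₁ s₂ K (by linarith : 0 ≤ N)
        (by linarith [hξ.1] : N ≤ ξ) (by linarith [hξ.2])).2
      calc φ ξ ^ 2 ≤ 1 := pow_le_one₀ (hφ0 ξ) (hφ1 ξ)
        _ = b ^ 2 * weight s₁ s₂ (N, K) := hb.symm
        _ ≤ b ^ 2 * (4 ^ |s₁| * weight s₁ s₂ (ξ, K)) := by gcongr
        _ = _ := by ring
  have h2 : N + 4 * γ - (N + 2 * γ) = 2 * γ := by ring
  rw [Real.volume_Icc, h2, ← ENNReal.ofReal_mul (by positivity),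
    ENNReal.ofReal_rpow_of_nonneg (by positivity) (by norm_num)] at h
  have h3 := ENNReal.toReal_mono ENNReal.ofReal_ne_top h
  rw [ENNReal.toReal_ofReal (by positivity)] at h3
  refine (pow_le_pow_left₀ ENNReal.toReal_nonneg h3 2).trans_eq ?_
  rw [← Real.rpow_natCast, ← Real.rpow_mul (by positivity)]
  norm_num

/-- The flow of small data is not `C²` in any space of data containing the real valued ones. -/
theorem not_c2WellPosed_of_realValued_le {α s₁ s₂ : ℝ} (hα : α < 5)
    {E : Submodule ℝ (Sobolev s₁ s₂)} (hE : realValued s₁ s₂ ≤ E) :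
    ¬ C2WellPosed.{u} α s₁ s₂ E := by
  rintro ⟨T, hT, X, _, _, _, ι, V, Φ, hF⟩
  obtain ⟨C, hC0, hres⟩ := exists_resonant_frequencies hα
  -- With `t ≤ C⁻¹` the phase stays at most one up to time `t`, and `t` does not depend on `N`, so
  -- the constant `A` below is fixed before the frequencies are chosen.
  set t : ℝ := min T C⁻¹ with ht
  have ht0 : 0 < t := lt_min hT (inv_pos.2 hC0)
  have htT : t ≤ T := min_le_left _ _
  have htC : t * C ≤ 1 := by
    rw [← le_div_iff₀ hC0, one_div]
    exact min_le_right _ _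
  obtain ⟨A, hA0, hA⟩ := hF.exists_duhamel_bound ⟨t, by linarith, htT⟩
  set M : ℝ := 17 ^ |s₁| with hM
  set M' : ℝ := 4 ^ |s₁| with hM'
  -- Squaring lower bound ≤ upper bound gives `t² N² b² γ⁴ / 4 ≤ 64 A² M² γ² · 2 M' b² γ`, that is,
  -- `N² γ ≤ 512 A² M² M' / t²`; the `+ 1` makes the contradiction strict.
  obtain ⟨N, γ, K, hN, hγ, hγ1, hR, hresC⟩ := hres (512 * A ^ 2 * M ^ 2 * M' / t ^ 2 + 1)
  set b : ℝ := weight s₁ s₂ (N, K) ^ (-(1 / 2) : ℝ) with hb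
  have hw := weight_pos s₁ s₂ (N, K)
  have hb0 : 0 < b := Real.rpow_pos_of_pos hw _
  have hbw : b ^ 2 * weight s₁ s₂ (N, K) = 1 := by
    rw [hb, ← Real.rpow_natCast, ← Real.rpow_mul hw.le]
    norm_num
    rw [Real.rpow_neg_one]
    exact inv_mul_cancel₀ hw.ne'
  obtain ⟨h, hreal, hdata, hnorm⟩ := exists_sobolev_data hN hγ hγ1 s₁ s₂ hbw
  obtain ⟨φ, hφ, hφ0, hφ1, hφs, hφi⟩ := exists_bump (by linarith : 0 ≤ N) hγ
  have htI : t ∈ Icc (-T) T := ⟨by linarith, htT⟩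
  obtain ⟨q, hq⟩ := hF.hasDuhamel (fderiv ℝ Φ 0 ⟨h, hE hreal⟩) t htI K _ hφ
  have hupper := hA ⟨h, hE hreal⟩ K _ q hφ hq
  have hev : ∀ s ∈ Icc 0 t, ∀ᵐ p ∂dualMeasure,
      curveValue hT (ι (fderiv ℝ Φ 0 ⟨h, hE hreal⟩)) s p = evolvedData α s N γ b K p := by
    intro s hs
    have := hF.linearisation ⟨h, hE hreal⟩ (t := s) ⟨by linarith [hs.1], hs.2.trans htT⟩
    filter_upwards [this, hdata] with p h1 h2
    rw [h1, h2, evolvedData]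
  have hlower : t * (N * (b * γ / 2) * ∫ ξ, φ ξ) ≤ q.im := by
    refine ge_of_tendsto ((Complex.continuous_im.tendsto q).comp hq) ?_
    filter_upwards [eventually_ge_atTop (max ⌈N + 1⌉₊ K.natAbs)] with n hn
    refine im_duhamelApprox_ge hT hN hγ hγ1 hb0 hresC hC0.le ht0.le htC ?_ ?_ hev hφ hφ0 hφs
    · exact Nat.ceil_le.1 ((le_max_left _ _).trans hn)
    · rw [Int.abs_eq_natAbs]
      exact_mod_cast (le_max_right _ _).trans hn
  have hd := dualNorm_bump_le hN hγ hγ1 hbw hφ0 hφ1 hφs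
  set d := (dualNorm s₁ s₂ K fun ξ => (φ ξ : ℂ)).toReal with hdd
  have hd0 : 0 ≤ d := ENNReal.toReal_nonneg
  have h1 : t * (N * (b * γ / 2) * γ) ≤ A * (M * (8 * γ)) * d := by
    calc t * (N * (b * γ / 2) * γ) ≤ t * (N * (b * γ / 2) * ∫ ξ, φ ξ) := by gcongr
      _ ≤ ‖q‖ := hlower.trans ((le_abs_self _).trans (Complex.abs_im_le_norm q))
      _ ≤ A * ‖h‖ ^ 2 * d := hupper
      _ ≤ _ := by gcongr
  have h2 : (t * (N * (b * γ / 2) * γ)) ^ 2 ≤ (A * (M * (8 * γ))) ^ 2 * (M' * b ^ 2 * (2 * γ)) := by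
    calc _ ≤ (A * (M * (8 * γ)) * d) ^ 2 := pow_le_pow_left₀ (by positivity) h1 2
      _ = (A * (M * (8 * γ))) ^ 2 * d ^ 2 := by ring
      _ ≤ _ := by gcongr
  have h3 : N ^ 2 * γ ≤ 512 * A ^ 2 * M ^ 2 * M' / t ^ 2 := by
    rw [le_div_iff₀ (by positivity)]
    have h4 : 0 < b ^ 2 * γ ^ 3 / 4 := by positivity
    refine le_of_mul_le_mul_right ?_ h4
    calc N ^ 2 * γ * t ^ 2 * (b ^ 2 * γ ^ 3 / 4) = (t * (N * (b * γ / 2) * γ)) ^ 2 := by ring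
      _ ≤ _ := h2
      _ = _ := by ring
  linarith

end KPCylinder
end

theorem mainTheorem5 (α s₁ s₂ : ℝ) (hα : α < 5) :
    ¬ KPCylinder.C2WellPosed.{u} α s₁ s₂ ⊤ ∧
      ¬ KPCylinder.C2WellPosed.{u} α s₁ s₂ (KPCylinder.realValued s₁ s₂) :=
  ⟨KPCylinder.not_c2WellPosed_of_realValued_le hα le_top,
    KPCylinder.not_c2WellPosed_of_realValued_le hα le_rfl⟩
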